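/- Let $\mathcal{C}yc$ denote the family of all (finite or infinite) cyclic subgroups of a group. For a discrete group $G$ and a family $\mathcal F$ of subgroups of $G$ (closed under conjugation and under taking subgroups), a model for $E_{\mathcal F}(G)$ is a $G$-CW-complex $X$ such that the fixed point set $X^H$ is contractible for every $H\in\mathcal F$ and empty for every subgroup $H\notin\mathcal F$. It is of finite type if for every $n$ it has only finitely many $G$-orbits of $n$-cells. $E(\mathbb Z/2)$ denotes a model for the family consisting only of the trivial subgroup of $\mathbb Z/2$. Let $D_\infty=\langle s,t\mid s^2=1,\ sts=t^{-1}\rangle$ be the infinite dihedral group. (1) There are models of finite type for $E(\mathbb Z/2)$, and for each of them the join $\mathbb Z * E(\mathbb Z/2)$ (the quotient of $\mathbb Z\times E(\mathbb Z/2)\times[0,1]$ by $[x,y,0]=[x,y',0]$ and $[x,y,1]=[x',y,1]$), with the $D_\infty$-action $$t\cdot[x,y,q]=[x+2,y,q],\qquad s\cdot[x,y,q]=[-x,s\cdot y,q],$$ where on the right $s$ acts on $E(\mathbb Z/2)$ as the generator of $\mathbb Z/2$, is a model of finite type for $E_{\mathcal{C}yc}(D_\infty)$. (2) Every model for $E_{\mathcal{C}yc}(D_\infty)$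 is infinite-dimensional. (3) A virtually cyclic group $G$ has a model of finite type for $E_{\mathcal{C}yc}(G)$ if and only if $G$ is finite, infinite cyclic or infinite dihedral. -/

import Mathlib

universe u v

/-- A family of subgroups of `G`: closed under conjugation and under taking subgroups. -/
structure SubgroupFamily (G : Type u) [Group G] where
  carrier : Set (Subgroup G)
  conj_mem : ∀ H ∈ carrier, ∀ g : G, H.map (MulAut.conj g).toMonoidHom ∈ carrier
  le_mem : ∀ H ∈ carrier, ∀ K : Subgroup G, K ≤ H → K ∈ carrier

/-- The family `Cyc` of all (finite or infinite) cyclic subgroups of `G`. -/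
def cycFamily (G : Type u) [Group G] : SubgroupFamily G where
  carrier := {H | IsCyclic H}
  conj_mem := by
    intro H hH g
    have : IsCyclic H := hH
    exact isCyclic_of_surjective _ ((MulAut.conj g).toMonoidHom.subgroupMap_surjective H)
  le_mem := by
    intro H hH K hK
    have : IsCyclic H := hH
    exact isCyclic_of_injective (Subgroup.inclusion hK) (Subgroup.inclusion_injective hK)

/-- The family consisting only of the trivial subgroup. -/
def trivialFamily (G : Type u) [Group G] : SubgroupFamily G where
  carrier := {⊥}
  conj_mem := by
    intro H hH g
    rw [Set.mem_singleton_iff] at hH ⊢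
    rw [hH, Subgroup.map_bot]
  le_mem := by
    intro H hH K hK
    rw [Set.mem_singleton_iff] at hH ⊢
    exact le_bot_iff.mp (hH ▸ hK)

/-- A `G`-CW-structure (for a discrete group `G`) on a `G`-space `X`: a CW structure on the
Hausdorff space `X`, together with an action of `G` on the set of `n`-cells for each `n`, such that
the characteristic maps assemble to `G`-equivariant maps `cell n × Dⁿ → X`, where `G` acts trivially
on the disc `Dⁿ`. Splitting the `G`-set `cell n` into orbits `G ⧸ H`, these are the equivariant
cells `G ⧸ H × Dⁿ`. -/
structure GCWComplex (G : Type u) [Group G] (X : Type v) [TopologicalSpace X] [MulAction G X]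
    extends Topology.CWComplex (Set.univ : Set X) where
  t2Space : T2Space X
  continuousConstSMul : ContinuousConstSMul G X
  [cellAction : ∀ n : ℕ, MulAction G (cell n)]
  map_smul : ∀ (n : ℕ) (g : G) (i : cell n), ∀ p ∈ Metric.closedBall (0 : Fin n → ℝ) 1,
    map n (g • i) p = g • map n i p

/-- A `G`-CW-complex is of finite type if for every `n` it has finitely many `G`-orbits of
`n`-cells. -/
def GCWComplex.FiniteType {G : Type u} [Group G] {X : Type v} [TopologicalSpace X] [MulAction G X]
    (c : GCWComplex G X) : Prop :=
  ∀ n : ℕ, Finite (@MulAction.orbitRel.Quotient G (c.cell n) _ (c.cellAction n))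

/-- A `G`-CW-complex is finite-dimensional if its underlying CW complex is. -/
def GCWComplex.FiniteDimensional {G : Type u} [Group G] {X : Type v} [TopologicalSpace X]
    [MulAction G X] (c : GCWComplex G X) : Prop :=
  letI := c.toCWComplex
  Topology.RelCWComplex.FiniteDimensional (Set.univ : Set X)

/-- The fixed-point condition for the classifying space of the family `F`: the fixed point set
`X^H` is contractible for `H ∈ F` and empty for every other subgroup `H`. -/
def HasClassifyingFixedPoints {G : Type u} [Group G] (F : SubgroupFamily G) (X : Type v)
    [TopologicalSpace X] [MulAction G X] : Prop :=
  (∀ H ∈ F.carrier, ContractibleSpace (MulAction.fixedPoints H X)) ∧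
    ∀ H ∉ F.carrier, MulAction.fixedPoints H X = ∅

/-- The `G`-space `X` is a model of finite type for `E_F(G)`. -/
def IsFiniteTypeModel {G : Type u} [Group G] (F : SubgroupFamily G) (X : Type v)
    [TopologicalSpace X] [MulAction G X] : Prop :=
  (∃ c : GCWComplex G X, c.FiniteType) ∧ HasClassifyingFixedPoints F X

/-- A group is virtually cyclic if it has a cyclic subgroup of finite index. -/
def IsVirtuallyCyclic (G : Type u) [Group G] : Prop :=
  ∃ H : Subgroup G, IsCyclic H ∧ H.FiniteIndex

/-- The identifications defining the join of two (nonempty) spaces. -/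
inductive JoinRel (A : Type u) (B : Type v) : A × B × unitInterval → A × B × unitInterval → Prop
  | left (a : A) (b b' : B) : JoinRel A B (a, b, 0) (a, b', 0)
  | right (a a' : A) (b : B) : JoinRel A B (a, b, 1) (a', b, 1)

/-- The join `A * B` of two nonempty spaces, as a quotient space of `A × B × [0, 1]`. -/
def TopJoin (A : Type u) (B : Type v) : Type (max u v) :=
  Quot (JoinRel A B)

instance (A : Type u) (B : Type v) [TopologicalSpace A] [TopologicalSpace B] :
    TopologicalSpace (TopJoin A B) :=
  inferInstanceAs (TopologicalSpace (Quot (JoinRel A B)))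

/-- The point `[a, b, q]` of the join. -/
def TopJoin.mk {A : Type u} {B : Type v} (a : A) (b : B) (q : unitInterval) : TopJoin A B :=
  Quot.mk _ (a, b, q)

/-- The map of joins induced by a pair of maps. -/
def TopJoin.map {A : Type u} {B : Type v} (f : A → A) (g : B → B) : TopJoin A B → TopJoin A B :=
  Quot.map (fun p => (f p.1, g p.2.1, p.2.2)) (by
    rintro _ _ (⟨a, b, b'⟩ | ⟨a, a', b⟩)
    · exact JoinRel.left _ _ _
    · exact JoinRel.right _ _ _)

theorem TopJoin.ind {A : Type u} {B : Type v} {P : TopJoin A B → Prop}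
    (h : ∀ a b q, P (TopJoin.mk a b q)) (z : TopJoin A B) : P z :=
  Quot.ind (fun p => h p.1 p.2.1 p.2.2) z

/-- The action of `D_∞ = ⟨s, t | s² = 1, sts = t⁻¹⟩` on `ℤ` with `t x = x + 2` and `s x = -x`.
Here `t = r 1`, `s = sr 0`, so that `r i = t ^ i` and `sr i = s t ^ i`. -/
def dihedralOnInt : DihedralGroup 0 → ℤ → ℤ
  | .r i, x => x + 2 * (i.cast : ℤ)
  | .sr i, x => -(x + 2 * (i.cast : ℤ))

/-- The projection `D_∞ → ℤ/2` with kernel `⟨t⟩`. -/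
def dihedralSign : DihedralGroup 0 → Multiplicative (ZMod 2)
  | .r _ => 1
  | .sr _ => Multiplicative.ofAdd 1

/-- The action of `D_∞` on the join `ℤ * Y` for a `ℤ/2`-space `Y`:
`t [x, y, q] = [x + 2, y, q]` and `s [x, y, q] = [-x, s y, q]`. -/
instance dihedralJoinAction (Y : Type v) [MulAction (Multiplicative (ZMod 2)) Y] :
    MulAction (DihedralGroup 0) (TopJoin ℤ Y) where
  smul g := TopJoin.map (dihedralOnInt g) (fun y => dihedralSign g • y)
  one_smul := by
    refine TopJoin.ind fun x y q => ?_
    change TopJoin.mk (x + 2 * ((0 : ZMod 0).cast : ℤ)) ((1 : Multiplicative (ZMod 2)) • y) q = _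
    simp
  mul_smul g h := by
    refine TopJoin.ind fun x y q => ?_
    change TopJoin.mk (dihedralOnInt (g * h) x) (dihedralSign (g * h) • y) q =
      TopJoin.mk (dihedralOnInt g (dihedralOnInt h x)) (dihedralSign g • dihedralSign h • y) q
    have h1 : dihedralOnInt (g * h) x = dihedralOnInt g (dihedralOnInt h x) := by
      rcases g with i | i <;> rcases h with j | j <;>
        simp [dihedralOnInt] <;> ring
    have h2 : dihedralSign (g * h) = dihedralSign g * dihedralSign h := by
      rcases g with i | i <;> rcases h with j | j <;> (simp [dihedralSign]; try decide)
    rw [h1, h2, mul_smul]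

theorem t_smul_mk (Y : Type v) [MulAction (Multiplicative (ZMod 2)) Y] (x : ℤ) (y : Y)
    (q : unitInterval) :
    (DihedralGroup.r 1 : DihedralGroup 0) • TopJoin.mk x y q = TopJoin.mk (x + 2) y q := by
  change TopJoin.mk (x + 2 * ((1 : ZMod 0).cast : ℤ)) ((1 : Multiplicative (ZMod 2)) • y) q = _
  simp

theorem s_smul_mk (Y : Type v) [MulAction (Multiplicative (ZMod 2)) Y] (x : ℤ) (y : Y)
    (q : unitInterval) :
    (DihedralGroup.sr 0 : DihedralGroup 0) • TopJoin.mk x y q =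
      TopJoin.mk (-x) ((Multiplicative.ofAdd (1 : ZMod 2)) • y) q := by
  change TopJoin.mk (-(x + 2 * ((0 : ZMod 0).cast : ℤ))) _ q = _
  simp
  rfl

/-! Let Y be a free contractible ℤ/2-complex. `D_∞` acts on ℤ by t x = x + 2, s x = -x, so that
every integer is fixed by exactly one reflection and by no nontrivial translation, and it acts on Y
through its quotient ℤ/2. In the join, a cyclic subgroup containing a reflection fixes a single
integer, a nontrivial group of translations fixes exactly Y, and the trivial group fixes everything;
these sets are contractible. The reflections are free on Y, so a subgroup containing a reflection
and having a fixed point lies in the stabilizer of an integer, which has order two. A subgroup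
without reflections is cyclic. The cells of the join come from ℤ, from the cells of Y and from their
products, and ℤ has finitely many orbits, which gives finite type (`isFiniteTypeModel_topJoin`).

Models for finite groups, ℤ/2 in particular, come from `IteratedCone S`, a contractible complex
built functorially from a finite `G`-set `S`. A subgroup fixing an element of `S` preserves the
contraction to that vertex, and a subgroup fixing none has no fixed point
(`isFiniteTypeModel_iteratedCone`). For a cyclic group, `S` is one point.

Infinite-dimensionality: X^⟨t⟩ is contractible, and s acts on it without fixed points, since `D_∞`
is not cyclic. If X had cells only in dimensions below m, functions concentrated on the n-cells, one
for each n < m, would be m odd functions on X^⟨t⟩ without a common zero. A contractible space with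
an involution admits no such functions; this form of Borsuk–Ulam is `exists_common_zero_of_odd`. It
is proved with mod 2 chains: contracting again and again produces hemispheres `e_k` with ∂`e_(k+1)`
= (1 + σ)`e_k`, on which a cup product of coboundaries of sign functions evaluates to 1, while a
fine subdivision makes it 0.

Classification: in a model of finite type every element fixes a 0-cell, so the stabilizers of
finitely many 0-cells are cyclic groups containing a conjugate of every element
(`exists_cyclic_cover`). In an infinite virtually cyclic group this forces the centralizer of a
suitable infinite cyclic normal subgroup to be torsion-free, hence cyclic
(`eq_one_of_commute_of_isOfFinOrder`, `isCyclic_of_torsionFree`). It has index at most two, which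
leaves ℤ and `D_∞`. -/

/-! ### A combinatorial Borsuk–Ulam argument modulo two

A cochain on a set `Y` is a function on lists of points of `Y`; the empty list is allowed, so that
the cochain complex is augmented. -/

/-- The value on a list of the coboundary of a cochain modulo two. -/
def coboundary {Y : Type*} : List Y → (List Y → ZMod 2) → ZMod 2
  | [], _ => 0
  | y :: l, θ => θ l + coboundary l (fun w => θ (y :: w))

/-- The pull-back of a cochain along the prism between the maps `a` and `b`. -/
def prism {Y : Type*} (a b : Y → Y) : List Y → (List Y → ZMod 2) → ZMod 2
  | [], _ => 0
  | y :: l, θ => θ (a y :: b y :: l.map b) + prism a b l (fun w => θ (a y :: w))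

section Cochains

variable {Y : Type*}

theorem coboundary_add (l : List Y) (θ η : List Y → ZMod 2) :
    coboundary l (fun w => θ w + η w) = coboundary l θ + coboundary l η := by
  induction l generalizing θ η with
  | nil => simp [coboundary]
  | cons y l ih => simp only [coboundary, ih]; ring

theorem coboundary_zero (l : List Y) : coboundary l (fun _ => 0) = 0 := by
  induction l with
  | nil => rfl
  | cons y l ih => simp only [coboundary, ih, add_zero]

theorem coboundary_map (f : Y → Y) (l : List Y) (θ : List Y → ZMod 2) :
    coboundary (l.map f) θ = coboundary l (fun w => θ (w.map f)) := by
  induction l generalizing θ with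
  | nil => rfl
  | cons y l ih => simp only [List.map_cons, coboundary, ih]

theorem prism_add (a b : Y → Y) (l : List Y) (θ η : List Y → ZMod 2) :
    prism a b l (fun w => θ w + η w) = prism a b l θ + prism a b l η := by
  induction l generalizing θ η with
  | nil => simp [prism]
  | cons y l ih => simp only [prism, ih]; ring

/-- The chain homotopy formula modulo two. The prism sums `θ` over the lists a y₀, …, a yᵢ, b yᵢ, …,
b y_k; faces shared by neighbouring lists, and those omitting another vertex, cancel in pairs. -/
theorem prism_coboundary (a b : Y → Y) (l : List Y) (θ : List Y → ZMod 2) :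
    prism a b l (fun w => coboundary w θ) + coboundary l (fun w => prism a b w θ) =
      θ (l.map a) + θ (l.map b) := by
  induction l generalizing θ with
  | nil => simp only [prism, coboundary, List.map_nil, CharTwo.add_self_eq_zero]
  | cons y l ih =>
    have h := ih (fun w => θ (a y :: w))
    simp only [prism, coboundary, List.map_cons, prism_add, coboundary_add, coboundary_map]
    have e : ∀ x : ZMod 2, x + x = 0 := CharTwo.add_self_eq_zero
    linear_combination h + e (prism a b l θ) + e (θ (a y :: l.map b)) +
      e (coboundary l fun w => θ (a y :: b y :: w.map b))

/-- The prism of a homotopy `h` with `M` steps. -/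
def longPrism (h : ℕ → Y → Y) (M : ℕ) (l : List Y) (θ : List Y → ZMod 2) : ZMod 2 :=
  ∑ j ∈ Finset.range M, prism (h j) (h (j + 1)) l θ

theorem longPrism_nil (h : ℕ → Y → Y) (M : ℕ) (θ : List Y → ZMod 2) :
    longPrism h M [] θ = 0 := by
  simp [longPrism, prism]

/-- Each intermediate map occurs as an end of two consecutive prisms and cancels. -/
theorem longPrism_coboundary (h : ℕ → Y → Y) (M : ℕ) (l : List Y) (θ : List Y → ZMod 2) :
    longPrism h M l (fun w => coboundary w θ) + coboundary l (fun w => longPrism h M w θ) =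
      θ (l.map (h 0)) + θ (l.map (h M)) := by
  induction M with
  | zero => simp only [longPrism, Finset.range_zero, Finset.sum_empty, coboundary_zero,
      CharTwo.add_self_eq_zero]
  | succ M ih =>
    simp only [longPrism, Finset.sum_range_succ, coboundary_add] at ih ⊢
    have e : ∀ x : ZMod 2, x + x = 0 := CharTwo.add_self_eq_zero
    linear_combination ih + prism_coboundary (h M) (h (M + 1)) l θ + e (θ (l.map (h M)))

/-- The value of a cochain on the `k`-dimensional hemisphere, which is obtained from the
`(k - 1)`-dimensional sphere by coning with the homotopy `h`. -/
def hemisphere (h : ℕ → Y → Y) (M : ℕ) (σ : Y → Y) (y₀ : Y) : ℕ → (List Y → ZMod 2) → ZMod 2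
  | 0, θ => θ [y₀]
  | k + 1, θ => hemisphere h M σ y₀ k (fun l => longPrism h M l θ + longPrism h M (l.map σ) θ)

theorem hemisphere_add (h : ℕ → Y → Y) (M : ℕ) (σ : Y → Y) (y₀ : Y) (k : ℕ)
    (θ η : List Y → ZMod 2) :
    hemisphere h M σ y₀ k (fun l => θ l + η l) =
      hemisphere h M σ y₀ k θ + hemisphere h M σ y₀ k η := by
  induction k generalizing θ η with
  | zero => rfl
  | succ k ih =>
    simp only [hemisphere]
    rw [← ih]
    congr 1
    funext l
    simp only [longPrism, prism_add, Finset.sum_add_distrib]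
    ring

theorem hemisphere_zero (h : ℕ → Y → Y) (M : ℕ) (σ : Y → Y) (y₀ : Y) (k : ℕ) :
    hemisphere h M σ y₀ k (fun _ => 0) = 0 := by
  have := hemisphere_add h M σ y₀ k (fun _ => 0) (fun _ => 0)
  simpa using this

/-- With `e_k` the chain on which `hemisphere` evaluates, this says ∂`e_(k+1)` = (1 + σ)`e_k`:
`e_(k+1)` is the cone on the cycle (1 + σ)`e_k`. -/
theorem hemisphere_coboundary (h : ℕ → Y → Y) (M : ℕ) (σ : Y → Y) (y₀ : Y)
    (hσ : ∀ y, σ (σ y) = y) (h0 : ∀ y, h 0 y = y) (hM : ∀ y, h M y = y₀) (k : ℕ)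
    (θ : List Y → ZMod 2) :
    hemisphere h M σ y₀ (k + 1) (fun l => coboundary l θ) =
      hemisphere h M σ y₀ k (fun l => θ l + θ (l.map σ)) := by
  have e : ∀ x : ZMod 2, x + x = 0 := CharTwo.add_self_eq_zero
  have h0' : h 0 = id := funext h0
  have hM' : ∀ l : List Y, (l.map σ).map (h M) = l.map (h M) := by
    intro l; rw [List.map_map]; congr 1; funext y; simp [hM]
  have hσ' : ∀ l : List Y, (l.map σ).map σ = l := by
    intro l; rw [List.map_map, show σ ∘ σ = id from funext hσ, List.map_id]
  -- The far ends of the two long prisms agree because `h M` is constant, so they cancel; the near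
  -- ends give `θ l + θ (l.map σ)`.
  have key : ∀ θ : List Y → ZMod 2, ∀ l : List Y,
      longPrism h M l (fun w => coboundary w θ) + longPrism h M (l.map σ) (fun w => coboundary w θ)
        = (θ l + θ (l.map σ)) +
          coboundary l (fun w => longPrism h M w θ + longPrism h M (w.map σ) θ) := by
    intro θ l
    have h1 := longPrism_coboundary h M l θ
    have h2 := longPrism_coboundary h M (l.map σ) θ
    rw [coboundary_map] at h2
    rw [h0', List.map_id] at h1 h2
    rw [hM'] at h2
    rw [coboundary_add]
    linear_combination h1 + h2 + e (θ (l.map (h M))) -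
      e (coboundary l fun w => longPrism h M w θ) -
      e (coboundary l fun w => longPrism h M (w.map σ) θ)
  induction k generalizing θ with
  | zero =>
    simp only [hemisphere]
    rw [key]
    -- The only face of the list `[y₀]` is the empty list, whose prism vanishes.
    simp [coboundary, longPrism_nil]
  | succ k ih =>
    rw [hemisphere]
    simp only [key]
    rw [hemisphere_add, ih]
    simp only [hσ']
    -- (1 + σ)² = 0 modulo two, so (1 + σ)`e_k` has no boundary.
    have : ∀ l, (longPrism h M l θ + longPrism h M (l.map σ) θ) +
        (longPrism h M (l.map σ) θ + longPrism h M l θ) = 0 := fun l => by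
      linear_combination e (longPrism h M l θ) + e (longPrism h M (l.map σ) θ)
    simp only [this, hemisphere_zero, add_zero]

/-- The cup product of the coboundaries of the `0`-cochains `s i, s (i + 1), …`. -/
def cupCoboundaries (s : ℕ → Y → ZMod 2) : ℕ → List Y → ZMod 2
  | _, [] => 0
  | _, [_] => 1
  | i, v :: w :: l => (s i v + s i w) * cupCoboundaries s (i + 1) (w :: l)

/-- The cup product of the coboundaries of the `0`-cochains `s i, s (i + 1), …` with a last
factor `s j` that is not replaced by its coboundary. -/
def cupPrimitive (s : ℕ → Y → ZMod 2) : ℕ → List Y → ZMod 2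
  | _, [] => 0
  | i, [v] => s i v
  | i, v :: w :: l => (s i v + s i w) * cupPrimitive s (i + 1) (w :: l)

theorem coboundary_mul (l : List Y) (a : ZMod 2) (θ : List Y → ZMod 2) :
    coboundary l (fun w => a * θ w) = a * coboundary l θ := by
  induction l generalizing θ with
  | nil => simp [coboundary]
  | cons y l ih => simp only [coboundary, ih]; ring

/-- Leibniz rule: all factors but the last are cocycles. At least two entries are needed: on `[v]`
the left side is 0 and the empty product on the right is 1. -/
theorem coboundary_cupPrimitive (s : ℕ → Y → ZMod 2) (i : ℕ) (v w : Y) (l : List Y) :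
    coboundary (v :: w :: l) (cupPrimitive s i) = cupCoboundaries s i (v :: w :: l) := by
  have e : ∀ x : ZMod 2, x + x = 0 := CharTwo.add_self_eq_zero
  induction l generalizing i v w with
  | nil =>
    simp only [coboundary, cupPrimitive, cupCoboundaries]
    ring
  | cons x l ih =>
    have h := ih (i + 1) w x
    rw [cupCoboundaries, ← h, coboundary, coboundary]
    simp only [cupPrimitive]
    rw [coboundary_mul, coboundary]
    have h' : coboundary (w :: x :: l) (cupPrimitive s (i + 1)) =
        cupPrimitive s (i + 1) (x :: l) + (cupPrimitive s (i + 1) (w :: l) +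
          coboundary l fun u => cupPrimitive s (i + 1) (w :: x :: u)) := rfl
    rw [h']
    linear_combination e (s i x * cupPrimitive s (i + 1) (x :: l))

/-- The differences are invariant under `σ` and the last factor changes by 1, so adding the two
products leaves the product of the differences. -/
theorem cupPrimitive_add_map (s : ℕ → Y → ZMod 2) (σ : Y → Y)
    (hs : ∀ i y, s i (σ y) = s i y + 1) (i : ℕ) (v : Y) (l : List Y) :
    cupPrimitive s i (v :: l) + cupPrimitive s i ((v :: l).map σ) =
      cupCoboundaries s i (v :: l) := by
  have e : ∀ x : ZMod 2, x + x = 0 := CharTwo.add_self_eq_zero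
  induction l generalizing i v with
  | nil =>
    simp only [List.map_cons, List.map_nil, cupPrimitive, cupCoboundaries, hs]
    linear_combination e (s i v)
  | cons w l ih =>
    have h := ih (i + 1) w
    simp only [List.map_cons, cupPrimitive, cupCoboundaries, hs] at h ⊢
    rw [← h]
    linear_combination cupPrimitive s (i + 1) (σ w :: List.map σ l) * e 1

/-- The cube whose grid points carry the simplices of the hemispheres. -/
def coneCube (F : unitInterval → Y → Y) (σ : Y → Y) (y₀ : Y) :
    (k : ℕ) → (Fin k → Bool) → (Fin k → unitInterval) → Y
  | 0, _, _ => y₀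
  | k + 1, ε, u => F (u 0) (cond (ε 0) σ id (coneCube F σ y₀ k (Fin.tail ε) (Fin.tail u)))

theorem prism_eq_zero (a b : Y → Y) (l : List Y) (θ : List Y → ZMod 2)
    (hθ : ∀ l' : List Y, l'.length = l.length + 1 → (∀ v ∈ l', ∃ w ∈ l, v = a w ∨ v = b w) →
      θ l' = 0) : prism a b l θ = 0 := by
  induction l generalizing θ with
  | nil => rfl
  | cons y l ih =>
    rw [prism, hθ, ih, add_zero]
    · intro l' hl' hv
      refine hθ _ (by simp [hl']) ?_
      intro v hv'
      rcases List.mem_cons.1 hv' with rfl | hv'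
      · exact ⟨y, by simp, Or.inl rfl⟩
      · obtain ⟨w, hw, h⟩ := hv v hv'
        exact ⟨w, List.mem_cons_of_mem _ hw, h⟩
    · simp
    · intro v hv
      simp only [List.mem_cons, List.mem_map] at hv
      rcases hv with rfl | rfl | ⟨w, hw, rfl⟩
      · exact ⟨y, by simp, Or.inl rfl⟩
      · exact ⟨y, by simp, Or.inr rfl⟩
      · exact ⟨w, List.mem_cons_of_mem _ hw, Or.inr rfl⟩

/-- The point `j / M` of the unit interval. -/
noncomputable def gridPoint (M j : ℕ) : unitInterval := Set.projIcc 0 1 zero_le_one (j / M : ℝ)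

/-- The lists making up `e_k` have `k + 1` entries, all on one cube `coneCube` with parameters
within `1 / M` of a common point: a prism adds one coordinate taking two neighbouring grid values.
-/
theorem hemisphere_eq_zero (F : unitInterval → Y → Y) (M : ℕ) (σ : Y → Y) (y₀ : Y) (k : ℕ)
    (θ : List Y → ZMod 2)
    (hθ : ∀ l : List Y, l.length = k + 1 → (∃ (ε : Fin k → Bool) (c : Fin k → unitInterval),
      ∀ v ∈ l, ∃ u, dist u c ≤ 1 / M ∧ v = coneCube F σ y₀ k ε u) → θ l = 0) :
    hemisphere (fun j => F (gridPoint M j)) M σ y₀ k θ = 0 := by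
  induction k generalizing θ with
  | zero =>
    refine hθ [y₀] rfl ⟨fun _ => true, fun _ => 0, ?_⟩
    intro v hv
    refine ⟨fun _ => 0, ?_, by simpa [coneCube] using hv⟩
    simp
  | succ k ih =>
    refine ih _ ?_
    rintro l hl ⟨ε, c, hc⟩
    have key : ∀ e : Bool, longPrism (fun j => F (gridPoint M j)) M (l.map (cond e σ id)) θ
        = 0 := by
      intro e
      refine Finset.sum_eq_zero fun j hj => ?_
      refine prism_eq_zero _ _ _ _ fun l' hl' hv => ?_
      refine hθ l' (by simpa [hl] using hl') ⟨Fin.cons e ε, Fin.cons (gridPoint M j) c, ?_⟩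
      have hM : (0 : ℝ) < M := by
        have := Finset.mem_range.1 hj
        exact_mod_cast (by omega : 0 < M)
      have hgrid : dist (gridPoint M (j + 1)) (gridPoint M j) ≤ 1 / M := by
        have h1 : dist (gridPoint M (j + 1)) (gridPoint M j) ≤
            dist (((j + 1 : ℕ) : ℝ) / M) ((j : ℝ) / M) := by
          have := (LipschitzWith.projIcc (zero_le_one (α := ℝ))).dist_le_mul
            (((j + 1 : ℕ) : ℝ) / M) ((j : ℝ) / M)
          simpa [gridPoint] using this
        refine h1.trans (le_of_eq ?_)
        rw [Real.dist_eq, ← sub_div]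
        push_cast
        rw [add_sub_cancel_left, abs_of_pos (by positivity)]
      intro v hv'
      obtain ⟨w, hw, hvw⟩ := hv v hv'
      obtain ⟨w', hw', rfl⟩ := List.mem_map.1 hw
      obtain ⟨u, hu, rfl⟩ := hc w' hw'
      have hfin : ∀ t : unitInterval, dist t (gridPoint M j) ≤ 1 / M →
          dist (Fin.cons t u : Fin (k + 1) → unitInterval) (Fin.cons (gridPoint M j) c)
            ≤ 1 / M := by
        intro t ht
        rw [dist_pi_le_iff (by positivity)]
        intro i
        refine Fin.cases ?_ (fun i => ?_) i
        · simpa using ht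
        · simpa using (dist_le_pi_dist u c i).trans hu
      rcases hvw with rfl | rfl
      · refine ⟨Fin.cons (gridPoint M j) u, hfin _ (by simp), ?_⟩
        simp [coneCube]
      · refine ⟨Fin.cons (gridPoint M (j + 1)) u, hfin _ hgrid, ?_⟩
        simp [coneCube]
    have h1 := key false
    have h2 := key true
    simp only [cond_false, cond_true, List.map_id] at h1 h2
    rw [h1, h2, add_zero]

/-- Only lists with `k + 1` entries enter `e_k`; this lets the cup product identities, which fail on
very short lists, be applied. -/
theorem hemisphere_congr (h : ℕ → Y → Y) (M : ℕ) (σ : Y → Y) (y₀ : Y) (k : ℕ)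
    (θ η : List Y → ZMod 2) (hθ : ∀ l : List Y, l.length = k + 1 → θ l = η l) :
    hemisphere h M σ y₀ k θ = hemisphere h M σ y₀ k η := by
  have hP : ∀ (a b : Y → Y) (l : List Y) (θ η : List Y → ZMod 2),
      (∀ l' : List Y, l'.length = l.length + 1 → θ l' = η l') →
      prism a b l θ = prism a b l η := by
    intro a b l
    induction l with
    | nil => intros; rfl
    | cons y l ih =>
      intro θ η h
      rw [prism, prism, h _ (by simp), ih _ (fun w => η (a y :: w))]
      intro l' hl'
      exact h _ (by simp [hl'])
  induction k generalizing θ η with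
  | zero => exact hθ [y₀] rfl
  | succ k ih =>
    refine ih _ _ fun l hl => ?_
    simp only [longPrism]
    congr 1 <;>
    · refine Finset.sum_congr rfl fun j _ => hP _ _ _ _ _ fun l' hl' => hθ _ ?_
      simpa [hl] using hl'

/-- Stokes: writing the product of `k + 1` coboundaries as the coboundary of `cupPrimitive` and
moving to ∂`e_(k+1)` = (1 + σ)`e_k` leaves the product of `k` coboundaries on `e_k`. On `e_0` the
empty product is 1. -/
theorem hemisphere_cupCoboundaries (h : ℕ → Y → Y) (M : ℕ) (σ : Y → Y) (y₀ : Y)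
    (hσ : ∀ y, σ (σ y) = y) (h0 : ∀ y, h 0 y = y) (hM : ∀ y, h M y = y₀)
    (s : ℕ → Y → ZMod 2) (hs : ∀ i y, s i (σ y) = s i y + 1) (k : ℕ) :
    hemisphere h M σ y₀ k (cupCoboundaries s 0) = 1 := by
  induction k with
  | zero => rfl
  | succ k ih =>
    rw [hemisphere_congr h M σ y₀ (k + 1) _ (fun l => coboundary l (cupPrimitive s 0)),
      hemisphere_coboundary h M σ y₀ hσ h0 hM, ← ih]
    · refine hemisphere_congr _ _ _ _ _ _ _ fun l hl => ?_
      rcases l with _ | ⟨v, l⟩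
      · simp at hl
      · exact cupPrimitive_add_map s σ hs 0 v l
    · intro l hl
      rcases l with _ | ⟨v, _ | ⟨w, l⟩⟩
      · simp at hl
      · simp at hl
      · exact (coboundary_cupPrimitive s 0 v w l).symm

theorem cupCoboundaries_eq_zero (s : ℕ → Y → ZMod 2) (l : List Y) (i j : ℕ)
    (hj : j + 1 < l.length) (hs : ∀ v ∈ l, ∀ w ∈ l, s (i + j) v = s (i + j) w) :
    cupCoboundaries s i l = 0 := by
  induction l generalizing i j with
  | nil => rfl
  | cons v l ih =>
    rcases l with _ | ⟨w, l⟩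
    · simp at hj
    rw [cupCoboundaries]
    rcases j with _ | j
    · rw [add_zero] at hs
      rw [hs v (by simp) w (by simp), CharTwo.add_self_eq_zero, zero_mul]
    · rw [ih (i + 1) j (by simpa using hj), mul_zero]
      intro a ha b hb
      have := hs a (List.mem_cons_of_mem _ ha) b (List.mem_cons_of_mem _ hb)
      rwa [show i + 1 + j = i + (j + 1) by ring]

end Cochains

theorem continuous_coneCube {Y : Type*} [TopologicalSpace Y] (F : unitInterval → Y → Y)
    (hF : Continuous fun p : unitInterval × Y => F p.1 p.2) (σ : Y → Y) (hσ : Continuous σ)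
    (y₀ : Y) (k : ℕ) (ε : Fin k → Bool) : Continuous (coneCube F σ y₀ k ε) := by
  induction k with
  | zero => exact continuous_const
  | succ k ih =>
    have h1 : Continuous (cond (ε 0) σ id) := by
      cases ε 0
      · exact continuous_id
      · exact hσ
    have h2 : Continuous fun u : Fin (k + 1) → unitInterval => (Fin.tail u : Fin k → _) :=
      continuous_pi fun i => continuous_apply _
    exact hF.comp ((continuous_apply 0).prodMk (h1.comp ((ih (Fin.tail ε)).comp h2)))

/-- A contractible space with an involution `σ` has no finite list of odd functions without a
common zero. -/
theorem exists_common_zero_of_odd {Y : Type*} [TopologicalSpace Y] [ContractibleSpace Y]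
    (σ : Y → Y) (hσc : Continuous σ) (hσ : ∀ y, σ (σ y) = y) (m : ℕ) (φ : ℕ → Y → ℝ)
    (hφ : ∀ i, Continuous (φ i)) (hodd : ∀ i y, φ i (σ y) = -φ i y) :
    ∃ y, ∀ i < m, φ i y = 0 := by
  classical
  by_contra! hne
  have hfix : ∀ y, σ y ≠ y := by
    intro y hy
    obtain ⟨i, -, hi⟩ := hne y
    have := hodd i y
    rw [hy] at this
    exact hi (by linarith)
  -- An odd function with values in ℤ/2, with no continuity: a well-order picks one point of each
  -- pair {y, σ y}.
  obtain ⟨s₀, hs₀⟩ : ∃ s₀ : Y → ZMod 2, ∀ y, s₀ (σ y) = s₀ y + 1 := by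
    let _ : LinearOrder Y := IsWellOrder.linearOrder WellOrderingRel
    refine ⟨fun y => if y < σ y then 1 else 0, fun y => ?_⟩
    simp only [hσ]
    rcases lt_or_gt_of_ne (hfix y) with h | h
    · rw [if_pos h, if_neg (not_lt.2 h.le), zero_add]
    · rw [if_neg (not_lt.2 h.le), if_pos h]; rfl
  -- The sign of `φ i`, completed by `s₀` on the zero set so as to be odd everywhere. The jumps are
  -- harmless: on a simplex inside `U (i, b)` the factor belonging to this `i` vanishes.
  let s : ℕ → Y → ZMod 2 := fun i y =>
    if 0 < φ i y then 1 else if φ i y < 0 then 0 else s₀ y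
  have hs : ∀ i y, s i (σ y) = s i y + 1 := by
    intro i y
    simp only [s, hodd, hs₀]
    rcases lt_trichotomy (φ i y) 0 with h | h | h
    · simp [h, not_lt.2 h.le]
    · simp [h]
    · simp only [h, Left.neg_neg_iff, if_true, Left.neg_pos_iff, not_lt.2 h.le, if_false]; rfl
  obtain ⟨y₀, ⟨H⟩⟩ := id_nullhomotopic Y
  let F : unitInterval → Y → Y := fun t y => H (t, y)
  have hF : Continuous fun p : unitInterval × Y => F p.1 p.2 := H.continuous
  let U : ℕ × Bool → Set Y := fun p => if p.2 then {y | p.1 < m ∧ 0 < φ p.1 y}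
    else {y | p.1 < m ∧ φ p.1 y < 0}
  have hU : ∀ p, IsOpen (U p) := by
    rintro ⟨i, b⟩
    by_cases hi : i < m
    · cases b
      · simpa [U, hi] using isOpen_lt (hφ i) continuous_const
      · simpa [U, hi] using isOpen_lt continuous_const (hφ i)
    · cases b <;> simp [U, hi]
  have hcover : ∀ y, ∃ p, y ∈ U p := by
    intro y
    obtain ⟨i, hi, h⟩ := hne y
    rcases lt_or_gt_of_ne h with h | h
    · exact ⟨(i, false), by simp [U, hi, h]⟩
    · exact ⟨(i, true), by simp [U, hi, h]⟩
  have hleb : ∀ ε : Fin m → Bool, ∃ δ > 0, ∀ c : Fin m → unitInterval, ∃ p,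
      Metric.ball c δ ⊆ coneCube F σ y₀ m ε ⁻¹' U p := by
    intro ε
    obtain ⟨δ, hδ, h⟩ := lebesgue_number_lemma_of_metric (s := Set.univ)
      (c := fun p => coneCube F σ y₀ m ε ⁻¹' U p) isCompact_univ
      (fun p => (hU p).preimage (continuous_coneCube F hF σ hσc y₀ m ε))
      (fun u _ => Set.mem_iUnion.2 (hcover _))
    exact ⟨δ, hδ, fun c => h c trivial⟩
  choose δ hδ hball using hleb
  -- A mesh below the Lebesgue numbers of all `2 ^ m` cubes puts every simplex of the hemisphere
  -- into a single `U p`.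
  obtain ⟨M, hM⟩ : ∃ M : ℕ, ∀ ε, 1 / ((M + 1 : ℕ) : ℝ) < δ ε := by
    have : ∀ ε, ∀ᶠ M : ℕ in Filter.atTop, 1 / ((M + 1 : ℕ) : ℝ) < δ ε := by
      intro ε
      have := (tendsto_one_div_add_atTop_nhds_zero_nat (𝕜 := ℝ)).eventually_lt_const (hδ ε)
      simpa using this
    exact (Filter.eventually_all.2 this).exists
  have h1 := hemisphere_cupCoboundaries (fun j => F (gridPoint (M + 1) j)) (M + 1) σ y₀ hσ
    (fun y => by
      have : gridPoint (M + 1) 0 = 0 := by simp [gridPoint]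
      simp only [this]
      exact H.map_zero_left y)
    (fun y => by
      have : gridPoint (M + 1) (M + 1) = 1 := by
        have : ((M + 1 : ℕ) : ℝ) ≠ 0 := by positivity
        rw [gridPoint, div_self this, Set.projIcc_right]
        rfl
      simp only [this]
      exact H.map_one_left y) s hs m
  rw [hemisphere_eq_zero F (M + 1) σ y₀ m (cupCoboundaries s 0)] at h1
  · exact zero_ne_one h1
  rintro l hl ⟨ε, c, hc⟩
  obtain ⟨⟨i, b⟩, hp⟩ := hball ε c
  have hmem : ∀ v ∈ l, v ∈ U (i, b) := by
    intro v hv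
    obtain ⟨u, hu, rfl⟩ := hc v hv
    exact hp (Metric.mem_ball.2 (hu.trans_lt (hM ε)))
  obtain ⟨v₀, hv₀⟩ : ∃ v, v ∈ l := List.exists_mem_of_length_pos (by omega)
  have hi : i < m := by
    have := hmem v₀ hv₀
    cases b <;> simp [U] at this <;> exact this.1
  refine cupCoboundaries_eq_zero s l 0 i (by omega) ?_
  rw [zero_add]
  have hconst : ∀ v ∈ l, s i v = if b then 1 else 0 := by
    intro v hv
    have := hmem v hv
    cases b
    · simp only [U, Bool.false_eq_true, if_false, Set.mem_ofPred_eq] at this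
      simp [s, this.2, not_lt.2 this.2.le]
    · simp only [U, if_true, Set.mem_ofPred_eq] at this
      simp [s, this.2]
  intro v hv w hw
  rw [hconst v hv, hconst w hw]

section

open Metric Topology

/-! ### Cells of CW complexes -/

section CWGeneral

open RelCWComplex

/-- Data for a CW structure on a space with the weak topology: characteristic maps that are jointly
injective on the open cells. The continuity of their inverses is automatic. -/
structure CharacteristicMaps (X : Type v) [TopologicalSpace X] where
  cell : ℕ → Type v
  map : ∀ n, cell n → (Fin n → ℝ) → X
  continuousOn : ∀ n i, ContinuousOn (map n i) (closedBall 0 1)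
  injective : ∀ n m i j, ∀ p ∈ ball (0 : Fin n → ℝ) 1, ∀ q ∈ ball (0 : Fin m → ℝ) 1,
    map n i p = map m j q →
      (⟨n, i, p⟩ : Σ n, cell n × (Fin n → ℝ)) = ⟨m, j, q⟩
  mapsTo : ∀ n i, ∃ T : Set (Σ m, cell m), T.Finite ∧ ∀ p ∈ sphere (0 : Fin n → ℝ) 1,
    ∃ m < n, ∃ j, ⟨m, j⟩ ∈ T ∧ ∃ q ∈ closedBall (0 : Fin m → ℝ) 1, map n i p = map m j q
  closed : ∀ A : Set X, (∀ n i, IsClosed (A ∩ map n i '' closedBall 0 1)) → IsClosed A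
  surjective : ∀ x, ∃ n i, ∃ p ∈ closedBall (0 : Fin n → ℝ) 1, map n i p = x

namespace CharacteristicMaps

variable {X : Type v} [TopologicalSpace X] (D : CharacteristicMaps X)

theorem exists_ball (n : ℕ) (i : D.cell n) (p : Fin n → ℝ) (hp : p ∈ closedBall 0 1) :
    ∃ m ≤ n, ∃ j, ∃ q ∈ ball (0 : Fin m → ℝ) 1, D.map n i p = D.map m j q := by
  induction n using Nat.strong_induction_on with
  | _ n ih =>
    rw [← ball_union_sphere] at hp
    rcases hp with hp | hp
    · exact ⟨n, le_rfl, i, p, hp, rfl⟩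
    · obtain ⟨T, hT, hI⟩ := D.mapsTo n i
      obtain ⟨m, hm, j, -, q, hq, h⟩ := hI p hp
      obtain ⟨l, hl, j', q', hq', h'⟩ := ih m hm j q hq
      exact ⟨l, hl.trans hm.le, j', q', hq', h.trans h'⟩

theorem injOn (n : ℕ) (i : D.cell n) : Set.InjOn (D.map n i) (ball 0 1) := by
  intro p hp q hq h
  have := D.injective n n i i p hp q hq h
  simpa using this

theorem map_sphere_ne (n : ℕ) (i : D.cell n) (p q : Fin n → ℝ) (hp : p ∈ sphere 0 1)
    (hq : q ∈ ball 0 1) : D.map n i p ≠ D.map n i q := by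
  intro h
  obtain ⟨T, hT, hI⟩ := D.mapsTo n i
  obtain ⟨m, hm, j, -, r, hr, h'⟩ := hI p hp
  obtain ⟨l, hl, j', r', hr', h''⟩ := D.exists_ball m j r hr
  have := D.injective n l i j' q hq r' hr' (by rw [← h, h', h''])
  have : n = l := congrArg Sigma.fst this
  omega

/-- A characteristic map with its inverse on the open cell. -/
noncomputable def cellEquiv (n : ℕ) (i : D.cell n) : PartialEquiv (Fin n → ℝ) X :=
  (D.injOn n i).toPartialEquiv _ _

/-- The CW complex given by a family of characteristic maps. -/
@[reducible]
noncomputable def toCWComplex [T2Space X] : CWComplex (Set.univ : Set X) where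
  cell := D.cell
  map n i := D.cellEquiv n i
  source_eq _ _ := rfl
  continuousOn := D.continuousOn
  continuousOn_symm n i := by
    rw [continuousOn_iff_isClosed]
    intro t ht
    -- The image of a compact set is closed, and the image of the sphere does not meet the open
    -- cell, so this set cuts out the right part of it.
    refine ⟨D.map n i '' (closedBall 0 1 ∩ t), ?_, ?_⟩
    · exact (((isCompact_closedBall _ _).inter_right ht).image_of_continuousOn
        ((D.continuousOn n i).mono Set.inter_subset_left)).isClosed
    · ext x
      constructor
      · rintro ⟨hx, p, hp, rfl⟩
        refine ⟨⟨p, ⟨ball_subset_closedBall hp, ?_⟩, rfl⟩, p, hp, rfl⟩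
        have : (D.cellEquiv n i).symm (D.cellEquiv n i p) = p :=
          PartialEquiv.left_inv _ hp
        rw [← this]
        exact hx
      · rintro ⟨⟨p, ⟨hp, hpt⟩, rfl⟩, q, hq, h⟩
        rw [← ball_union_sphere] at hp
        rcases hp with hp | hp
        · have : (D.cellEquiv n i).symm (D.cellEquiv n i p) = p :=
            PartialEquiv.left_inv _ hp
          refine ⟨?_, p, hp, rfl⟩
          change (D.cellEquiv n i).symm (D.cellEquiv n i p) ∈ t
          rwa [this]
        · exact (D.map_sphere_ne n i p q hp hq h.symm).elim
  pairwiseDisjoint' := by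
    rintro ⟨n, i⟩ - ⟨m, j⟩ - hne
    refine Set.disjoint_left.2 ?_
    rintro _ ⟨p, hp, rfl⟩ ⟨q, hq, h⟩
    have := D.injective n m i j p hp q hq h.symm
    apply hne
    rw [Sigma.mk.injEq] at this
    obtain ⟨rfl, h2⟩ := this
    have := eq_of_heq h2
    simp only [Prod.mk.injEq] at this
    rw [this.1]
  mapsTo' n i := by
    obtain ⟨T, hT, hI⟩ := D.mapsTo n i
    refine ⟨fun m => (hT.preimage (sigma_mk_injective (i := m)).injOn).toFinset, fun p hp => ?_⟩
    obtain ⟨m, hm, j, hj, q, hq, h⟩ := hI p hp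
    simp only [Set.mem_iUnion, Set.Finite.mem_toFinset]
    exact ⟨m, hm, j, hj, q, hq, h.symm⟩
  closed' A _ := D.closed A
  union' := by
    refine Set.eq_univ_of_forall fun x => ?_
    obtain ⟨n, i, p, hp, rfl⟩ := D.surjective x
    simp only [Set.mem_iUnion]
    exact ⟨n, i, p, hp, rfl⟩

end CharacteristicMaps

variable {X : Type v} [TopologicalSpace X] [CWComplex (Set.univ : Set X)]

theorem exists_map_ball_eq (x : X) :
    ∃ (n : ℕ) (i : cell (Set.univ : Set X) n), ∃ p ∈ ball (0 : Fin n → ℝ) 1, map n i p = x := by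
  have : x ∈ (Set.univ : Set X) := trivial
  rw [← CWComplex.iUnion_openCell_eq_complex (C := (Set.univ : Set X))] at this
  simp only [Set.mem_iUnion] at this
  obtain ⟨n, i, p, hp, h⟩ := this
  exact ⟨n, i, p, hp, h⟩

theorem map_ball_injective {n m : ℕ} {i : cell (Set.univ : Set X) n} {j : cell (Set.univ : Set X) m}
    {p : Fin n → ℝ} {q : Fin m → ℝ} (hp : p ∈ ball 0 1) (hq : q ∈ ball 0 1)
    (h : map n i p = map m j q) :
    (⟨n, i, p⟩ : Σ n, cell (Set.univ : Set X) n × (Fin n → ℝ)) = ⟨m, j, q⟩ := by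
  have h1 : (⟨n, i⟩ : Σ n, cell (Set.univ : Set X) n) = ⟨m, j⟩ := by
    refine eq_of_not_disjoint_openCell ?_
    rw [Set.not_disjoint_iff]
    exact ⟨_, ⟨p, hp, rfl⟩, q, hq, h.symm⟩
  rw [Sigma.mk.injEq] at h1
  obtain ⟨rfl, h2⟩ := h1
  obtain rfl := eq_of_heq h2
  have : p = q := by
    refine (map n i).injOn ?_ ?_ h
    · rwa [source_eq]
    · rwa [source_eq]
  rw [this]

theorem exists_map_ball_eq_of_sphere {n : ℕ} (i : cell (Set.univ : Set X) n) {p : Fin n → ℝ}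
    (hp : p ∈ sphere 0 1) : ∃ m < n, ∃ j : cell (Set.univ : Set X) m,
      ∃ q ∈ ball (0 : Fin m → ℝ) 1, map n i p = map m j q := by
  obtain ⟨I, hI⟩ := CWComplex.cellFrontier_subset_finite_openCell n i
  have := hI ⟨p, hp, rfl⟩
  simp only [Set.mem_iUnion] at this
  obtain ⟨m, hm, j, -, q, hq, h⟩ := this
  exact ⟨m, hm, j, q, hq, h.symm⟩

variable [T2Space X] {Z : Type*} [TopologicalSpace Z]

theorem isClosed_preimage_inter_closedCell {f : X → Z} {n : ℕ} {i : cell (Set.univ : Set X) n}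
    (hf : ContinuousOn (fun p => f (map n i p)) (closedBall 0 1)) {T : Set Z} (hT : IsClosed T) :
    IsClosed (f ⁻¹' T ∩ map n i '' closedBall 0 1) := by
  have h1 : IsClosed (closedBall (0 : Fin n → ℝ) 1 ∩ (fun p => f (map n i p)) ⁻¹' T) :=
    hf.preimage_isClosed_of_isClosed isClosed_closedBall hT
  have h2 : IsCompact (closedBall (0 : Fin n → ℝ) 1 ∩ (fun p => f (map n i p)) ⁻¹' T) :=
    (isCompact_closedBall (0 : Fin n → ℝ) 1).of_isClosed_subset h1 Set.inter_subset_left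
  have h3 := h2.image_of_continuousOn
    ((RelCWComplex.continuousOn n i).mono Set.inter_subset_left)
  convert h3.isClosed using 1
  ext x
  constructor
  · rintro ⟨hx, p, hp, rfl⟩
    exact ⟨p, ⟨hp, hx⟩, rfl⟩
  · rintro ⟨p, ⟨hp, hx⟩, rfl⟩
    exact ⟨hx, p, hp, rfl⟩

/-- A function on a CW complex is continuous if it is continuous on every cell. -/
theorem continuous_of_continuousOn_cells {f : X → Z}
    (hf : ∀ (n : ℕ) (i : cell (Set.univ : Set X) n),
      ContinuousOn (fun p => f (map n i p)) (closedBall 0 1)) : Continuous f := by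
  refine continuous_iff_isClosed.2 fun T hT => ?_
  exact CWComplex.closed' (C := (Set.univ : Set X)) _ (Set.subset_univ _)
    fun n i => isClosed_preimage_inter_closedCell (hf n i) hT

/-- A CW complex is a quotient of the disjoint union of its closed cells. -/
theorem isQuotientMap_closedCells :
    IsQuotientMap fun z : Σ i : (Σ n, cell (Set.univ : Set X) n), closedBall (0 : Fin i.1 → ℝ) 1 =>
      map z.1.1 z.1.2 z.2.1 := by
  refine isQuotientMap_iff_isClosed.2 ⟨fun x => ?_, fun A => ?_⟩
  · obtain ⟨n, i, p, hp, rfl⟩ := exists_map_ball_eq x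
    exact ⟨⟨⟨n, i⟩, ⟨p, ball_subset_closedBall hp⟩⟩, rfl⟩
  · rw [isClosed_sigma_iff]
    constructor
    · rintro hA ⟨n, i⟩
      exact hA.preimage (continuousOn_iff_continuous_domRestrict.1
        (RelCWComplex.continuousOn (C := (Set.univ : Set X)) n i))
    · intro hA
      refine CWComplex.closed' (C := (Set.univ : Set X)) _ (Set.subset_univ _) fun n i => ?_
      have h1 := (hA ⟨n, i⟩).isCompact.image (continuousOn_iff_continuous_domRestrict.1
        (RelCWComplex.continuousOn (C := (Set.univ : Set X)) n i))
      convert h1.isClosed using 1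
      ext x
      constructor
      · rintro ⟨hx, p, hp, rfl⟩
        exact ⟨⟨p, hp⟩, hx, rfl⟩
      · rintro ⟨⟨p, hp⟩, hx, rfl⟩
        exact ⟨hx, p, hp, rfl⟩

/-- The sphere is mapped into finitely many closed cells of lower dimension, and a finite union of
closed sets is closed. -/
theorem continuousOn_sphere_of_lower {f : X → Z} {n : ℕ} (i : cell (Set.univ : Set X) n)
    (hf : ∀ m < n, ∀ j : cell (Set.univ : Set X) m,
      ContinuousOn (fun p => f (map m j p)) (closedBall 0 1)) :
    ContinuousOn (fun p => f (map n i p)) (sphere 0 1) := by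
  rw [continuousOn_iff_isClosed]
  intro T hT
  obtain ⟨I, hI⟩ := CWComplex.mapsTo n i
  let B : Set X := ⋃ m ∈ Finset.range n, ⋃ j ∈ I m, f ⁻¹' T ∩ map m j '' closedBall 0 1
  have hB : IsClosed B := by
    refine isClosed_biUnion_finset fun m hm => isClosed_biUnion_finset fun j _ => ?_
    exact isClosed_preimage_inter_closedCell (hf m (Finset.mem_range.1 hm) j) hT
  refine ⟨sphere 0 1 ∩ map n i ⁻¹' B, ?_, ?_⟩
  · exact ((RelCWComplex.continuousOn n i).mono sphere_subset_closedBall).preimage_isClosed_of_isClosed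
      isClosed_sphere hB
  · ext p
    constructor
    · rintro ⟨h1, h2⟩
      refine ⟨⟨h2, ?_⟩, h2⟩
      have := hI h2
      simp only [Set.mem_iUnion] at this
      obtain ⟨m, hm, j, hj, h⟩ := this
      simp only [Set.mem_preimage, B, Set.mem_iUnion]
      exact ⟨m, Finset.mem_range.2 hm, j, hj, h1, h⟩
    · rintro ⟨⟨-, h⟩, h2⟩
      simp only [Set.mem_preimage, B, Set.mem_iUnion] at h
      obtain ⟨m, hm, j, hj, h, -⟩ := h
      exact ⟨h, h2⟩

/-- At the origin the factor `‖p‖` wins, because `g` is bounded on the compact sphere. -/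
theorem continuousOn_norm_mul {n : ℕ} {g : (Fin n → ℝ) → ℝ} (hg : ContinuousOn g (sphere 0 1)) :
    Continuous fun p : Fin n → ℝ => ‖p‖ * g (‖p‖⁻¹ • p) := by
  obtain ⟨B, hB⟩ := (isCompact_sphere (0 : Fin n → ℝ) 1).exists_bound_of_continuousOn hg
  have hmem : ∀ p : Fin n → ℝ, p ≠ 0 → ‖p‖⁻¹ • p ∈ sphere (0 : Fin n → ℝ) 1 := by
    intro p hp
    rw [mem_sphere_zero_iff_norm, norm_smul, norm_inv, norm_norm,
      inv_mul_cancel₀ (norm_ne_zero_iff.2 hp)]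
  rw [continuous_iff_continuousAt]
  intro p
  by_cases hp : p = 0
  · subst hp
    have : Filter.Tendsto (fun p : Fin n → ℝ => ‖p‖ * B) (𝓝 0) (𝓝 0) := by
      have : Continuous fun p : Fin n → ℝ => ‖p‖ * B := by fun_prop
      simpa using this.tendsto 0
    unfold ContinuousAt
    beta_reduce
    rw [norm_zero, zero_mul]
    refine squeeze_zero_norm (fun q => ?_) this
    by_cases hq : q = 0
    · simp [hq]
    · rw [norm_mul, norm_norm]
      exact mul_le_mul_of_nonneg_left (hB _ (hmem q hq)) (norm_nonneg q)
  · have h1 : ContinuousOn (fun p : Fin n → ℝ => ‖p‖⁻¹ • p) {0}ᶜ :=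
      (continuous_norm.continuousOn.inv₀ fun q hq => norm_ne_zero_iff.2 hq).smul continuousOn_id
    have h2 : ContinuousOn (fun p : Fin n → ℝ => ‖p‖ * g (‖p‖⁻¹ • p)) {0}ᶜ :=
      continuous_norm.continuousOn.mul (hg.comp h1 fun q hq => hmem q hq)
    exact h2.continuousAt (isOpen_compl_singleton.mem_nhds hp)

/-- The radial extension to a CW complex of a function on the `k`-skeleton that is
`a k i * (1 - ‖p‖)` on the `k`-cell `i`. -/
theorem exists_radial_extension (k : ℕ) (a : ∀ n, cell (Set.univ : Set X) n → ℝ) :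
    ∃ f : X → ℝ, Continuous f ∧
      (∀ n < k, ∀ (i : cell (Set.univ : Set X) n), ∀ p ∈ closedBall 0 1, f (map n i p) = 0) ∧
      (∀ (i : cell (Set.univ : Set X) k), ∀ p ∈ closedBall 0 1,
        f (map k i p) = a k i * (1 - ‖p‖)) ∧
      (∀ n, k < n → ∀ (i : cell (Set.univ : Set X) n), ∀ p ∈ closedBall 0 1,
        f (map n i p) = ‖p‖ * f (map n i (‖p‖⁻¹ • p))) := by
  choose dim idx par hpar hmap using exists_map_ball_eq (X := X)
  have hcoord : ∀ n (i : cell (Set.univ : Set X) n), ∀ p ∈ ball (0 : Fin n → ℝ) 1,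
      (⟨dim (map n i p), idx (map n i p), par (map n i p)⟩ :
        Σ n, cell (Set.univ : Set X) n × (Fin n → ℝ)) = ⟨n, i, p⟩ :=
    fun n i p hp => map_ball_injective (hpar _) hp (hmap _)
  let step : (X → ℝ) → (Σ n, cell (Set.univ : Set X) n × (Fin n → ℝ)) → ℝ := fun F z =>
    if z.1 < k then 0 else if z.1 = k then a z.1 z.2.1 * (1 - ‖z.2.2‖) else
      ‖z.2.2‖ * F (map z.1 z.2.1 (‖z.2.2‖⁻¹ • z.2.2))
  -- The recursion expresses the value at a point by the value at a boundary point, which has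
  -- smaller `dim`; hence `F N x` is stable once `N > dim x`.
  let F : ℕ → X → ℝ := fun N => Nat.rec (fun _ => 0)
    (fun _ F x => step F ⟨dim x, idx x, par x⟩) N
  have hFs : ∀ N x, F (N + 1) x = step (F N) ⟨dim x, idx x, par x⟩ := fun _ _ => rfl
  have hsph : ∀ n (i : cell (Set.univ : Set X) n) (p : Fin n → ℝ), p ≠ 0 →
      dim (map n i (‖p‖⁻¹ • p)) < n := by
    intro n i p hp
    have hmem : ‖p‖⁻¹ • p ∈ sphere (0 : Fin n → ℝ) 1 := by
      rw [mem_sphere_zero_iff_norm, norm_smul, norm_inv, norm_norm,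
        inv_mul_cancel₀ (norm_ne_zero_iff.2 hp)]
    obtain ⟨m, hm, j, q, hq, h⟩ := exists_map_ball_eq_of_sphere i hmem
    rw [h]
    have : dim (map m j q) = m := congrArg Sigma.fst (hcoord m j q hq)
    rwa [this]
  have hstab : ∀ N x, dim x < N → F (N + 1) x = F N x := by
    intro N
    induction N with
    | zero => intro x hx; omega
    | succ N ih =>
      intro x hx
      rw [hFs (N + 1), hFs N]
      simp only [step]
      split_ifs with h1 h2
      · rfl
      · rfl
      · by_cases hp : par x = 0
        · rw [hp, norm_zero, zero_mul, zero_mul]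
        · rw [ih]
          have := hsph _ (idx x) _ hp
          omega
  have hstab' : ∀ x N, dim x < N → F N x = F (dim x + 1) x := by
    intro x N hN
    induction N, hN using Nat.le_induction with
    | base => rfl
    | succ N hN ih => rw [hstab N x hN, ih]
  let f : X → ℝ := fun x => F (dim x + 1) x
  have hf : ∀ n (i : cell (Set.univ : Set X) n), ∀ p ∈ ball (0 : Fin n → ℝ) 1,
      f (map n i p) = step f ⟨n, i, p⟩ := by
    intro n i p hp
    have h1 : f (map n i p) = step (F (dim (map n i p)))
      ⟨dim (map n i p), idx (map n i p), par (map n i p)⟩ := rfl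
    have h2 : dim (map n i p) = n := congrArg Sigma.fst (hcoord n i p hp)
    rw [h1, hcoord n i p hp, h2]
    simp only [step]
    split_ifs with h3 h4
    · rfl
    · rfl
    · by_cases hp0 : p = 0
      · rw [hp0, norm_zero, zero_mul, zero_mul]
      · rw [hstab' _ _ (hsph n i p hp0)]
  have hlow : ∀ n < k, ∀ (i : cell (Set.univ : Set X) n), ∀ p ∈ closedBall 0 1,
      f (map n i p) = 0 := by
    intro n hn i p hp
    rw [← ball_union_sphere] at hp
    rcases hp with hp | hp
    · rw [hf n i p hp]
      simp only [step, if_pos hn]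
    · obtain ⟨m, hm, j, q, hq, h⟩ := exists_map_ball_eq_of_sphere i hp
      rw [h, hf m j q hq]
      simp only [step, if_pos (hm.trans hn)]
  have hk : ∀ (i : cell (Set.univ : Set X) k), ∀ p ∈ closedBall 0 1,
      f (map k i p) = a k i * (1 - ‖p‖) := by
    intro i p hp
    rw [← ball_union_sphere] at hp
    rcases hp with hp | hp
    · rw [hf k i p hp]
      simp only [step, lt_irrefl, if_false, if_true]
    · obtain ⟨m, hm, j, q, hq, h⟩ := exists_map_ball_eq_of_sphere i hp
      rw [h, hlow m hm j q (ball_subset_closedBall hq), mem_sphere_zero_iff_norm.1 hp]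
      ring
  have hhigh : ∀ n, k < n → ∀ (i : cell (Set.univ : Set X) n), ∀ p ∈ closedBall 0 1,
      f (map n i p) = ‖p‖ * f (map n i (‖p‖⁻¹ • p)) := by
    intro n hn i p hp
    rw [← ball_union_sphere] at hp
    rcases hp with hp | hp
    · rw [hf n i p hp]
      simp only [step, if_neg (not_lt.2 hn.le), if_neg hn.ne']
    · rw [mem_sphere_zero_iff_norm.1 hp, inv_one, one_smul, one_mul]
  refine ⟨f, continuous_of_continuousOn_cells fun n => ?_, hlow, hk, hhigh⟩
  induction n using Nat.strong_induction_on with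
  | _ n ih =>
    intro i
    rcases lt_trichotomy n k with h | rfl | h
    · exact continuousOn_const.congr fun p hp => hlow n h i p hp
    · refine ContinuousOn.congr ?_ fun p hp => hk i p hp
      fun_prop
    · refine ContinuousOn.congr ?_ fun p hp => hhigh n h i p hp
      exact (continuousOn_norm_mul (continuousOn_sphere_of_lower i ih)).continuousOn

end CWGeneral

/-! ### Fixed points of `G`-CW-complexes -/

section GCW

open RelCWComplex

variable {G : Type u} [Group G] {X : Type v} [TopologicalSpace X] [MulAction G X]

/-- An element fixing a point of an open cell maps that cell to itself. -/
theorem GCWComplex.smul_cell_eq (c : GCWComplex G X) {n : ℕ} (i : c.cell n) {p : Fin n → ℝ}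
    (hp : p ∈ ball 0 1) (g : G) (hg : g • c.map n i p = c.map n i p) :
    (c.cellAction n).smul g i = i := by
  let _ := c.toCWComplex
  have h1 := c.map_smul n g i p (ball_subset_closedBall hp)
  have := map_ball_injective (X := X) hp hp (h1.trans hg)
  simp only [Sigma.mk.injEq, heq_eq_eq, Prod.mk.injEq, true_and, and_true] at this
  exact this

/-- If the fixed point set of `H` is nonempty, then it contains a `0`-cell. -/
theorem GCWComplex.exists_fixed_zero_cell (c : GCWComplex G X) (H : Subgroup G) (x : X)
    (hx : ∀ h ∈ H, h • x = x) : ∃ i : c.cell 0, ∀ h ∈ H, (c.cellAction 0).smul h i = i := by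
  let _ := c.toCWComplex
  have key : ∀ n, ∀ i : c.cell n, ∀ p ∈ ball (0 : Fin n → ℝ) 1,
      (∀ h ∈ H, h • c.map n i p = c.map n i p) →
      ∃ i : c.cell 0, ∀ h ∈ H, (c.cellAction 0).smul h i = i := by
    intro n
    induction n using Nat.strong_induction_on with
    | _ n ih =>
      intro i p hp hfix
      have hi : ∀ h ∈ H, (c.cellAction n).smul h i = i :=
        fun h hh => c.smul_cell_eq i hp h (hfix h hh)
      -- A fixed cell is fixed pointwise, its boundary included, since the action on the disc is
      -- trivial. For positive dimension a boundary point lies in a lower open cell.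
      rcases n with _ | n
      · exact ⟨i, hi⟩
      · obtain ⟨q, hq⟩ : (sphere (0 : Fin (n + 1) → ℝ) 1).Nonempty :=
          NormedSpace.sphere_nonempty.2 zero_le_one
        obtain ⟨m, hm, j, r, hr, h⟩ := exists_map_ball_eq_of_sphere (X := X) i hq
        refine ih m hm j r hr fun g hg => ?_
        have h1 := c.map_smul (n + 1) g i q (sphere_subset_closedBall hq)
        have h2 : c.map (n + 1) i q = g • c.map (n + 1) i q := by
          rw [← h1]
          exact congrArg (fun j => c.map (n + 1) j q) (hi g hg).symm
        have h' : c.map (n + 1) i q = c.map m j r := h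
        rw [h'] at h2
        exact h2.symm
  obtain ⟨n, i, p, hp, rfl⟩ := exists_map_ball_eq x
  exact key n i p hp hx

/-- A `G`-CW-structure given by characteristic maps and an action on the cells. -/
noncomputable def CharacteristicMaps.toGCWComplex [T2Space X] [ContinuousConstSMul G X]
    (D : CharacteristicMaps X) (act : ∀ n, MulAction G (D.cell n))
    (hact : ∀ n (g : G) (i : D.cell n), ∀ p ∈ closedBall (0 : Fin n → ℝ) 1,
      D.map n (g • i) p = g • D.map n i p) : GCWComplex G X where
  toCWComplex := D.toCWComplex
  t2Space := inferInstance
  continuousConstSMul := inferInstance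
  cellAction := act
  map_smul := hact

end GCW

/-! ### Models for the infinite dihedral group are infinite-dimensional -/

section InfiniteDimensional

/-- A group acting on a finite-dimensional complex: if `s` normalizes `H`, if `s ^ 2` is trivial and
if `H` and `s` have no common fixed point, then the fixed point set of `H` is not contractible. -/
theorem GCWComplex.not_contractibleSpace_fixedPoints {G : Type u} [Group G] {X : Type v}
    [TopologicalSpace X] [MulAction G X] (c : GCWComplex G X) (hfd : c.FiniteDimensional)
    (H : Subgroup G) (s : G) (hs : s * s = 1) (hsH : ∀ h ∈ H, s * h * s ∈ H)
    (hfix : ∀ x : X, (∀ h ∈ H, h • x = x) → s • x ≠ x) :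
    ¬ ContractibleSpace (MulAction.fixedPoints H X) := by
  classical
  intro hcontr
  let _ := c.toCWComplex
  let _ := c.t2Space
  let _ := c.continuousConstSMul
  let _ := c.cellAction
  obtain ⟨m, hm⟩ := Filter.eventually_atTop.1
    (RelCWComplex.FiniteDimensional.eventually_isEmpty_cell (C := (Set.univ : Set X)) (self := hfd))
  have hss : ∀ n (i : c.cell n), s • s • i = i := by
    intro n i; rw [← mul_smul, hs, one_smul]
  have hfixcell : ∀ n (i : c.cell n), (∀ h ∈ H, h • i = i) → ∀ h ∈ H, h • s • i = s • i := by
    intro n i hi h hh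
    have h1 : h * s = s * (s * h * s) := by
      rw [← mul_assoc, ← mul_assoc, hs, one_mul]
    rw [← mul_smul, h1, mul_smul, hi _ (hsH h hh)]
  have hmove : ∀ n (i : c.cell n), (∀ h ∈ H, h • i = i) → s • i ≠ i := by
    intro n i hi hsi
    have h0 : (0 : Fin n → ℝ) ∈ closedBall 0 1 := by simp
    refine hfix (c.map n i 0) (fun h hh => ?_) ?_
    · rw [← c.map_smul n h i 0 h0, hi h hh]
    · rw [← c.map_smul n s i 0 h0, hsi]
  -- The `H`-fixed cells come in pairs {i, s i} of distinct cells, which receive opposite signs ±1;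
  -- all other cells receive 0.
  obtain ⟨a, ha⟩ : ∃ a : ∀ n, c.cell n → ℝ, ∀ n i, a n (s • i) = -a n i ∧
      ((∀ h ∈ H, h • i = i) → a n i ≠ 0) := by
    let r : ∀ n, LinearOrder (c.cell n) := fun n => IsWellOrder.linearOrder WellOrderingRel
    refine ⟨fun n i => if ∀ h ∈ H, h • i = i then
      (if i < s • i then 1 else -1) else 0, fun n i => ⟨?_, ?_⟩⟩
    · by_cases hi : ∀ h ∈ H, h • i = i
      · simp only [if_pos hi, if_pos (hfixcell n i hi), hss]
        rcases lt_or_gt_of_ne (hmove n i hi) with h | h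
        · rw [if_pos h, if_neg (not_lt.2 h.le), neg_neg]
        · rw [if_neg (not_lt.2 h.le), if_pos h]
      · have hi' : ¬ ∀ h ∈ H, h • s • i = s • i := by
          intro h
          apply hi
          have := hfixcell n (s • i) h
          rwa [hss] at this
        simp only [if_neg hi, if_neg hi', neg_zero]
    · intro hi
      simp only [if_pos hi]
      split_ifs <;> norm_num
  choose f hfc hflow hfk hfhigh using fun k => exists_radial_extension (X := X) k a
  have hmaps : ∀ n (i : c.cell n) (p : Fin n → ℝ), p ∈ closedBall 0 1 →
      RelCWComplex.map (C := (Set.univ : Set X)) n (s • i : c.cell n) p =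
        s • RelCWComplex.map (C := (Set.univ : Set X)) n i p := fun n i p hp => c.map_smul n s i p hp
  have hodd : ∀ k x, f k (s • x) = -f k x := by
    intro k
    have key : ∀ n (i : c.cell n), ∀ p ∈ ball (0 : Fin n → ℝ) 1,
        f k (s • RelCWComplex.map (C := (Set.univ : Set X)) n i p) =
          -f k (RelCWComplex.map (C := (Set.univ : Set X)) n i p) := by
      intro n
      induction n using Nat.strong_induction_on with
      | _ n ih =>
        intro i p hp
        have hp' := ball_subset_closedBall hp
        rw [← hmaps n i p hp']
        rcases lt_trichotomy n k with h | rfl | h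
        · rw [hflow k n h _ p hp', hflow k n h _ p hp', neg_zero]
        · rw [hfk n _ p hp', hfk n _ p hp', (ha n i).1, neg_mul]
        · rw [hfhigh k n h _ p hp', hfhigh k n h _ p hp']
          by_cases hp0 : p = 0
          · rw [hp0, norm_zero, zero_mul, zero_mul, neg_zero]
          have hmem : ‖p‖⁻¹ • p ∈ sphere (0 : Fin n → ℝ) 1 := by
            rw [mem_sphere_zero_iff_norm, norm_smul, norm_inv, norm_norm,
              inv_mul_cancel₀ (norm_ne_zero_iff.2 hp0)]
          obtain ⟨l, hl, j, q, hq, hjq⟩ := exists_map_ball_eq_of_sphere (X := X) i hmem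
          rw [hmaps n i _ (sphere_subset_closedBall hmem), hjq, ih l hl j q hq, mul_neg]
    intro x
    obtain ⟨n, i, p, hp, rfl⟩ := exists_map_ball_eq x
    exact key n i p hp
  let σ : MulAction.fixedPoints H X → MulAction.fixedPoints H X := fun y => ⟨s • y.1, by
    rintro ⟨h, hh⟩
    change h • s • y.1 = s • y.1
    have h1 : h * s = s * (s * h * s) := by
      rw [← mul_assoc, ← mul_assoc, hs, one_mul]
    rw [← mul_smul, h1, mul_smul]
    exact congrArg (s • ·) (y.2 ⟨_, hsH h hh⟩)⟩
  -- A point of the fixed set lies in an open `H`-fixed cell of some dimension `n < m`, where `f n`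
  -- equals ±(1 - ‖p‖) ≠ 0; so a common zero is a contradiction.
  obtain ⟨y, hy⟩ := exists_common_zero_of_odd σ
    (((continuous_const_smul s).comp continuous_subtype_val).subtype_mk _)
    (fun y => Subtype.ext (by
      change s • s • y.1 = y.1
      rw [← mul_smul, hs, one_smul])) m (fun k y => f k y.1)
    (fun k => (hfc k).comp continuous_subtype_val) (fun k y => hodd k y.1)
  obtain ⟨n, i, p, hp, hy'⟩ := exists_map_ball_eq y.1
  have hn : n < m := by
    by_contra h
    exact (hm n (not_lt.1 h)).false i
  have h0 := hy n hn
  rw [← hy', hfk n i p (ball_subset_closedBall hp)] at h0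
  have hi : a n i ≠ 0 := (ha n i).2 fun h hh => by
    refine c.smul_cell_eq i hp h ?_
    have : c.map n i p = y.1 := hy'
    rw [this]
    exact y.2 ⟨h, hh⟩
  have hp1 : ‖p‖ < 1 := mem_ball_zero_iff.1 hp
  rcases mul_eq_zero.1 h0 with h | h
  · exact hi h
  · linarith

/-- The translation subgroup is cyclic and normalized by the reflection `sr 0`; together they
generate the noncyclic group `D_∞`, which has no fixed point. -/
theorem not_finiteDimensional_of_dihedral {X : Type v} [TopologicalSpace X]
    [MulAction (DihedralGroup 0) X] (c : GCWComplex (DihedralGroup 0) X)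
    (hX : HasClassifyingFixedPoints (cycFamily (DihedralGroup 0)) X) :
    ¬ c.FiniteDimensional := by
  intro hfd
  let H : Subgroup (DihedralGroup 0) := Subgroup.zpowers (.r 1)
  have hr : ∀ i : ZMod 0, DihedralGroup.r i ∈ H := fun i =>
    Subgroup.mem_zpowers_iff.2 ⟨(i.cast : ℤ), by simp⟩
  have hH : ∀ g ∈ H, ∃ i, g = DihedralGroup.r i := by
    intro g hg
    obtain ⟨k, rfl⟩ := Subgroup.mem_zpowers_iff.1 hg
    exact ⟨_, DihedralGroup.r_zpow _ _⟩
  refine c.not_contractibleSpace_fixedPoints hfd H (.sr 0) (by simp) ?_ ?_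
    (hX.1 H (inferInstanceAs (IsCyclic (Subgroup.zpowers _))))
  · intro h hh
    obtain ⟨i, rfl⟩ := hH h hh
    simpa using hr _
  · intro x hx hsx
    have hempty := hX.2 ⊤ (fun h => by
      have h1 : IsCyclic (⊤ : Subgroup (DihedralGroup 0)) := h
      have h2 : IsCyclic (DihedralGroup 0) :=
        isCyclic_of_surjective _ (Subgroup.topEquiv (G := DihedralGroup 0)).surjective
      exact DihedralGroup.not_isCyclic (n := 0) (by norm_num) h2)
    have : x ∈ MulAction.fixedPoints (⊤ : Subgroup (DihedralGroup 0)) X := by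
      rintro ⟨g, -⟩
      change g • x = x
      rcases g with i | i
      · exact hx _ (hr i)
      · have : DihedralGroup.sr i = DihedralGroup.sr 0 * DihedralGroup.r i := by simp
        rw [this, mul_smul, hx _ (hr i), hsx]
    rw [hempty] at this
    exact this

end InfiniteDimensional

/-! ### Iterated cones on a set

The space `IteratedCone S` is the union of cubes indexed by the nonempty words in `S`, where the cube
of a word `s w` is a cone with tip `s` over the cube of `w`. It is contractible if `S` is nonempty. -/

theorem mem_ball_succ_iff {n : ℕ} (p : Fin (n + 1) → ℝ) :
    p ∈ ball 0 1 ↔ p 0 ∈ Set.Ioo (-1 : ℝ) 1 ∧ (Fin.tail p : Fin n → ℝ) ∈ ball 0 1 := by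
  simp only [mem_ball_zero_iff, pi_norm_lt_iff zero_lt_one, Fin.forall_fin_succ, Real.norm_eq_abs,
    abs_lt, Set.mem_Ioo, Fin.tail]

theorem mem_closedBall_succ_iff {n : ℕ} (p : Fin (n + 1) → ℝ) :
    p ∈ closedBall 0 1 ↔
      p 0 ∈ Set.Icc (-1 : ℝ) 1 ∧ (Fin.tail p : Fin n → ℝ) ∈ closedBall 0 1 := by
  simp only [mem_closedBall_zero_iff, pi_norm_le_iff_of_nonneg zero_le_one, Fin.forall_fin_succ,
    Real.norm_eq_abs, abs_le, Set.mem_Icc, Fin.tail]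

theorem continuous_finTail (n : ℕ) :
    Continuous fun p : Fin (n + 1) → ℝ => (Fin.tail p : Fin n → ℝ) :=
  continuous_pi fun _ => continuous_apply _

theorem continuous_sigma_prod {ι : Type*} {A : ι → Type*} [∀ i, TopologicalSpace (A i)]
    {Y Z : Type*} [TopologicalSpace Y] [TopologicalSpace Z] {g : (Σ i, A i) × Y → Z}
    (hg : ∀ i, Continuous fun q : A i × Y => g (⟨i, q.1⟩, q.2)) : Continuous g := by
  have : Continuous (g ∘ (Homeomorph.sigmaProdDistrib (X := A) (Y := Y)).symm) :=
    continuous_sigma hg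
  exact (Homeomorph.comp_continuous_iff' _).1 this

/-- The set of points of the iterated cone on `S`; a point is given by the cube in whose interior it
lies and its coordinates in this cube. -/
inductive IteratedCone (S : Type v) : Type v
  | vertex (s : S) : IteratedCone S
  | cone (s : S) (u : Set.Ioo (0 : ℝ) 1) (x : IteratedCone S) : IteratedCone S

namespace IteratedCone

variable {S : Type v}

/-- The point at time `u` of the path from `x` to the vertex `s`. -/
noncomputable def coneAt (s : S) (u : ℝ) (x : IteratedCone S) : IteratedCone S :=
  if u ≤ 0 then x else if h : u < 1 then
    if h' : 0 < u then cone s ⟨u, h', h⟩ x else x else vertex s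

theorem coneAt_of_mem (s : S) (u : Set.Ioo (0 : ℝ) 1) (x : IteratedCone S) :
    coneAt s u x = cone s u x := by
  rw [coneAt, if_neg (not_le.2 u.2.1), dif_pos u.2.2, dif_pos u.2.1]

theorem coneAt_of_nonpos (s : S) {u : ℝ} (hu : u ≤ 0) (x : IteratedCone S) :
    coneAt s u x = x := by
  rw [coneAt, if_pos hu]

theorem coneAt_of_one_le (s : S) {u : ℝ} (hu : 1 ≤ u) (x : IteratedCone S) :
    coneAt s u x = vertex s := by
  rw [coneAt, if_neg (by linarith), dif_neg (not_lt.2 hu)]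

/-- The characteristic map of the cube of a word. -/
noncomputable def charMap : (n : ℕ) → (Fin (n + 1) → S) → (Fin n → ℝ) → IteratedCone S
  | 0, w, _ => vertex (w 0)
  | n + 1, w, p => coneAt (w 0) ((p 0 + 1) / 2) (charMap n (Fin.tail w) (Fin.tail p))

/-- The disjoint union of the closed cells. -/
abbrev Cells (S : Type v) : Type v :=
  Σ i : (Σ n, Fin (n + 1) → S), closedBall (0 : Fin i.1 → ℝ) 1

/-- The map from the disjoint union of the closed cells. -/
noncomputable def ofCells (z : Cells S) : IteratedCone S := charMap z.1.1 z.1.2 z.2.1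

noncomputable instance : TopologicalSpace (IteratedCone S) :=
  TopologicalSpace.coinduced ofCells inferInstance

/-- The dimension of the open cube of a point. -/
def dim : IteratedCone S → ℕ
  | vertex _ => 0
  | cone _ _ x => dim x + 1

theorem exists_charMap_eq (x : IteratedCone S) :
    ∃ n, dim x = n ∧ ∃ w, ∃ p ∈ ball (0 : Fin n → ℝ) 1, charMap n w p = x := by
  induction x with
  | vertex s => exact ⟨0, rfl, fun _ => s, 0, by simp, rfl⟩
  | cone s u x ih =>
    obtain ⟨n, hn, w, p, hp, h⟩ := ih
    refine ⟨n + 1, by rw [dim, hn], Fin.cons s w, Fin.cons (2 * u - 1 : ℝ) p, ?_, ?_⟩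
    · rw [mem_ball_succ_iff]
      refine ⟨?_, ?_⟩
      · have := u.2
        simp only [Fin.cons_zero, Set.mem_Ioo] at this ⊢
        constructor <;> linarith
      · rwa [Fin.tail_cons]
    · have hu : (2 * u - 1 + 1 : ℝ) / 2 = u := by ring
      rw [charMap, Fin.cons_zero, Fin.cons_zero, Fin.tail_cons, Fin.tail_cons, h, hu,
        coneAt_of_mem]

theorem dim_coneAt_le (s : S) (u : ℝ) (x : IteratedCone S) : dim (coneAt s u x) ≤ dim x + 1 := by
  rw [coneAt]
  split_ifs <;> simp [dim]

theorem dim_charMap_le (n : ℕ) (w : Fin (n + 1) → S) (p : Fin n → ℝ) :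
    dim (charMap n w p) ≤ n := by
  induction n with
  | zero => exact le_rfl
  | succ n ih =>
    exact (dim_coneAt_le _ _ _).trans (Nat.succ_le_succ (ih _ _))

/-- With `dim_charMap_le` this places the image of the boundary of a cube in cubes of lower
dimension. -/
theorem mem_ball_of_dim_charMap (n : ℕ) (w : Fin (n + 1) → S) (p : Fin n → ℝ)
    (h : dim (charMap n w p) = n) : p ∈ ball 0 1 := by
  induction n with
  | zero => simp [Subsingleton.elim p 0]
  | succ n ih =>
    have hle := dim_charMap_le n (Fin.tail w) (Fin.tail p)
    rw [charMap, coneAt] at h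
    rw [mem_ball_succ_iff]
    split_ifs at h with h1 h2 h3
    · omega
    · rw [dim] at h
      exact ⟨⟨by linarith, by linarith⟩, ih (Fin.tail w) _ (by omega)⟩
    · omega
    · simp [dim] at h

theorem charMap_succ_of_mem_ball {n : ℕ} (w : Fin (n + 2) → S) {p : Fin (n + 1) → ℝ}
    (hp : p ∈ ball 0 1) : ∃ u : Set.Ioo (0 : ℝ) 1, (u : ℝ) = (p 0 + 1) / 2 ∧
      charMap (n + 1) w p = cone (w 0) u (charMap n (Fin.tail w) (Fin.tail p)) := by
  have h := ((mem_ball_succ_iff p).1 hp).1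
  refine ⟨⟨(p 0 + 1) / 2, by linarith [h.1], by linarith [h.2]⟩, rfl, ?_⟩
  exact coneAt_of_mem (w 0) ⟨(p 0 + 1) / 2, by linarith [h.1], by linarith [h.2]⟩ _

theorem charMap_injective (n m : ℕ) (w : Fin (n + 1) → S) (w' : Fin (m + 1) → S) (p : Fin n → ℝ)
    (hp : p ∈ ball 0 1) (q : Fin m → ℝ) (hq : q ∈ ball 0 1) (h : charMap n w p = charMap m w' q) :
    (⟨n, w, p⟩ : Σ n, (Fin (n + 1) → S) × (Fin n → ℝ)) = ⟨m, w', q⟩ := by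
  induction n generalizing m with
  | zero =>
    rcases m with _ | m
    · have h' : w 0 = w' 0 := by simpa [charMap] using h
      have h1 : w = w' := by
        funext i
        obtain rfl : i = 0 := Subsingleton.elim (α := Fin 1) i 0
        exact h'
      rw [h1, Subsingleton.elim p q]
    · obtain ⟨u, -, hu⟩ := charMap_succ_of_mem_ball w' hq
      rw [hu] at h
      simp [charMap] at h
  | succ n ih =>
    obtain ⟨u, hu, hu'⟩ := charMap_succ_of_mem_ball w hp
    rcases m with _ | m
    · rw [hu'] at h
      simp [charMap] at h
    · obtain ⟨t, ht, ht'⟩ := charMap_succ_of_mem_ball w' hq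
      rw [hu', ht', cone.injEq] at h
      obtain ⟨h1, h2, h3⟩ := h
      have := ih m _ _ _ ((mem_ball_succ_iff p).1 hp).2 _ ((mem_ball_succ_iff q).1 hq).2 h3
      rw [Sigma.mk.injEq] at this
      obtain ⟨rfl, h4⟩ := this
      simp only [heq_eq_eq, Prod.mk.injEq] at h4
      have hw : w = w' := by
        rw [← Fin.cons_self_tail w, ← Fin.cons_self_tail w', h1, h4.1]
      have hpq : p = q := by
        have h0 : p 0 = q 0 := by rw [h2] at hu; linarith
        rw [← Fin.cons_self_tail p, ← Fin.cons_self_tail q, h0, h4.2]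
      rw [hw, hpq]

theorem surjective_ofCells : Function.Surjective (ofCells (S := S)) := by
  intro x
  obtain ⟨n, -, w, p, hp, h⟩ := exists_charMap_eq x
  exact ⟨⟨⟨_, w⟩, ⟨p, ball_subset_closedBall hp⟩⟩, h⟩

theorem isQuotientMap_ofCells : IsQuotientMap (ofCells (S := S)) :=
  ⟨⟨rfl⟩, surjective_ofCells⟩

theorem continuousOn_charMap (n : ℕ) (w : Fin (n + 1) → S) :
    ContinuousOn (charMap n w) (closedBall 0 1) := by
  rw [continuousOn_iff_continuous_domRestrict]
  exact isQuotientMap_ofCells.continuous.comp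
    (continuous_sigmaMk (σ := fun i : (Σ n, Fin (n + 1) → S) => closedBall (0 : Fin i.1 → ℝ) 1)
      (i := ⟨n, w⟩))

theorem continuous_of_charMap {Z : Type*} [TopologicalSpace Z] {f : IteratedCone S → Z}
    (hf : ∀ n w, ContinuousOn (fun p => f (charMap n w p)) (closedBall 0 1)) : Continuous f := by
  rw [isQuotientMap_ofCells.continuous_iff]
  refine continuous_sigma fun i => ?_
  exact continuousOn_iff_continuous_domRestrict.1 (hf i.1 i.2)

/-- The product of a quotient map with the unit interval is a quotient map, and on the cube of `w`
the cone is the characteristic map of the word `s w`. -/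
theorem continuous_coneAt (s : S) :
    Continuous fun z : IteratedCone S × unitInterval => coneAt s z.2 z.1 := by
  refine isQuotientMap_ofCells.continuous_lift_prod_left (continuous_sigma_prod fun i => ?_)
  obtain ⟨n, w⟩ := i
  let g : closedBall (0 : Fin n → ℝ) 1 × unitInterval → Fin (n + 1) → ℝ :=
    fun q => Fin.cons (2 * (q.2 : ℝ) - 1) q.1.1
  have hg : Continuous g := by
    refine continuous_pi fun j => ?_
    refine Fin.cases ?_ (fun j => ?_) j
    · simp only [g, Fin.cons_zero]; fun_prop
    · simp only [g, Fin.cons_succ]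
      exact (continuous_apply j).comp (continuous_subtype_val.comp continuous_fst)
  have hmem : ∀ q, g q ∈ closedBall (0 : Fin (n + 1) → ℝ) 1 := by
    intro q
    rw [mem_closedBall_succ_iff]
    simp only [g, Fin.cons_zero, Fin.tail_cons]
    exact ⟨⟨by linarith [q.2.2.1], by linarith [q.2.2.2]⟩, q.1.2⟩
  refine ((continuousOn_charMap (n + 1) (Fin.cons s w)).comp_continuous hg hmem).congr fun q => ?_
  have hu : (2 * (q.2 : ℝ) - 1 + 1) / 2 = q.2 := by ring
  simp only [Function.comp_apply, charMap, g, Fin.cons_zero, Fin.tail_cons, ofCells, hu]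

/-! ### The Hausdorff property, by viewing points as labelled measures on the interval. -/

section Separation

open Classical in
/-- The integral of the function `max (c - ·) 0` against the measure with label `a` of a point,
placed on the interval `[p, p + r]`. -/
noncomputable def weight (a : S) (c : ℝ) : IteratedCone S → ℝ → ℝ → ℝ
  | vertex s, p, r => if s = a then r * max (c - (p + r)) 0 else 0
  | cone s u x, p, r => (if s = a then u * r * max (c - (p + u * r)) 0 else 0) +
      weight a c x (p + u * r) (r * (1 - u))

theorem weight_zero (a : S) (c : ℝ) (x : IteratedCone S) (p : ℝ) : weight a c x p 0 = 0 := by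
  induction x generalizing p with
  | vertex s => simp [weight]
  | cone s u x ih => simp [weight, ih]

open Classical in
-- The formula for `cone` persists on the closed interval: for `u = 0` the new atom has no mass, for
-- `u = 1` the rest is squeezed into an interval of length 0. So `weight` respects the gluing of the
-- cubes.
theorem weight_coneAt (a : S) (c : ℝ) (s : S) (u : ℝ) (hu : u ∈ Set.Icc (0 : ℝ) 1)
    (x : IteratedCone S) (p r : ℝ) : weight a c (coneAt s u x) p r =
      (if s = a then u * r * max (c - (p + u * r)) 0 else 0) +
        weight a c x (p + u * r) (r * (1 - u)) := by
  rcases hu.1.eq_or_lt with rfl | h0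
  · simp [coneAt_of_nonpos]
  rcases hu.2.eq_or_lt with rfl | h1
  · simp [coneAt_of_one_le, weight, weight_zero]
  · rw [coneAt_of_mem s ⟨u, h0, h1⟩ x, weight]

theorem continuousOn_weight (a : S) (c : ℝ) (n : ℕ) (w : Fin (n + 1) → S) :
    ContinuousOn (fun z : (Fin n → ℝ) × ℝ × ℝ => weight a c (charMap n w z.1) z.2.1 z.2.2)
      {z | z.1 ∈ closedBall 0 1} := by
  classical
  induction n with
  | zero =>
    simp only [charMap, weight]
    split_ifs <;> fun_prop
  | succ n ih =>
    have h1 : ContinuousOn (fun z : (Fin (n + 1) → ℝ) × ℝ × ℝ =>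
        (if w 0 = a then (z.1 0 + 1) / 2 * z.2.2 * max (c - (z.2.1 + (z.1 0 + 1) / 2 * z.2.2)) 0
          else 0) + weight a c (charMap n (Fin.tail w) (Fin.tail z.1))
            (z.2.1 + (z.1 0 + 1) / 2 * z.2.2) (z.2.2 * (1 - (z.1 0 + 1) / 2)))
        {z | z.1 ∈ closedBall 0 1} := by
      refine ContinuousOn.add ?_ ?_
      · split_ifs <;> fun_prop
      · refine (ih (Fin.tail w)).comp (f := fun z : (Fin (n + 1) → ℝ) × ℝ × ℝ =>
          ((Fin.tail z.1 : Fin n → ℝ), z.2.1 + (z.1 0 + 1) / 2 * z.2.2,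
            z.2.2 * (1 - (z.1 0 + 1) / 2))) ?_ ?_
        · have := (continuous_finTail n).comp
            (continuous_fst (X := Fin (n + 1) → ℝ) (Y := ℝ × ℝ))
          refine (this.prodMk ?_).continuousOn
          fun_prop
        · intro z hz
          exact ((mem_closedBall_succ_iff z.1).1 hz).2
    refine h1.congr fun z hz => ?_
    have h := ((mem_closedBall_succ_iff z.1).1 hz).1
    exact weight_coneAt a c _ _ ⟨by linarith [h.1], by linarith [h.2]⟩ _ _ _

theorem continuous_weight (a : S) (c : ℝ) :
    Continuous fun x : IteratedCone S => weight a c x 0 1 := by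
  refine continuous_of_charMap fun n w => ?_
  exact (continuousOn_weight a c n w).comp (f := fun p => (p, (0 : ℝ), (1 : ℝ)))
    (by fun_prop) fun p hp => hp

/-- The position of the first atom of the measure of a point. -/
def firstPosition : IteratedCone S → ℝ
  | vertex _ => 1
  | cone _ u _ => u

/-- The first letter of a point. -/
def firstLetter : IteratedCone S → S
  | vertex s => s
  | cone s _ _ => s

theorem firstPosition_pos (x : IteratedCone S) : 0 < firstPosition x := by
  rcases x with s | ⟨s, u, x⟩
  · exact one_pos
  · exact u.2.1

theorem weight_nonneg (a : S) (c : ℝ) (x : IteratedCone S) (p r : ℝ) (hr : 0 ≤ r) :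
    0 ≤ weight a c x p r := by
  induction x generalizing p r with
  | vertex s =>
    rw [weight]
    split_ifs <;> positivity
  | cone s u x ih =>
    rw [weight]
    refine add_nonneg ?_ (ih _ _ (mul_nonneg hr (by linarith [u.2.2])))
    have := u.2.1.le
    split_ifs <;> positivity

theorem weight_eq_zero (a : S) (c : ℝ) (x : IteratedCone S) (p r : ℝ) (hr : 0 ≤ r)
    (hc : c ≤ p + firstPosition x * r) : weight a c x p r = 0 := by
  induction x generalizing p r with
  | vertex s =>
    rw [weight, max_eq_right (by simp only [firstPosition] at hc; linarith)]
    simp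
  | cone s u x ih =>
    simp only [firstPosition] at hc
    have h1 : 0 ≤ r * (1 - u) := mul_nonneg hr (by linarith [u.2.2])
    have h2 : 0 ≤ firstPosition x * (r * (1 - u)) := mul_nonneg (firstPosition_pos x).le h1
    rw [weight, max_eq_right (by linarith), ih _ _ h1 (by linarith)]
    simp

theorem weight_pos (c : ℝ) (x : IteratedCone S) (p r : ℝ) (hr : 0 < r)
    (hc : p + firstPosition x * r < c) : 0 < weight (firstLetter x) c x p r := by
  rcases x with s | ⟨s, u, x⟩
  · simp only [firstPosition, one_mul] at hc
    simp only [weight, firstLetter, if_true]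
    exact mul_pos hr (lt_max_of_lt_left (by linarith))
  · simp only [firstPosition] at hc
    simp only [weight, firstLetter, if_true]
    refine add_pos_of_pos_of_nonneg ?_
      (weight_nonneg _ _ _ _ _ (mul_nonneg hr.le (by linarith [u.2.2])))
    exact mul_pos (mul_pos u.2.1 hr) (lt_max_of_lt_left (by linarith))

theorem exists_weight_eq_zero (a : S) (x : IteratedCone S) (ha : firstLetter x ≠ a) (p r : ℝ)
    (hr : 0 < r) : ∃ c, p + firstPosition x * r < c ∧ weight a c x p r = 0 := by
  rcases x with s | ⟨s, u, x⟩
  · refine ⟨p + firstPosition (vertex s) * r + 1, by linarith, ?_⟩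
    rw [weight, if_neg (by exact ha)]
  · have h1 : 0 < r * (1 - u) := mul_pos hr (by linarith [u.2.2])
    have h2 := mul_pos (firstPosition_pos x) h1
    refine ⟨p + u * r + firstPosition x * (r * (1 - u)), by change p + u * r < _; linarith, ?_⟩
    rw [weight, if_neg (by exact ha), weight_eq_zero _ _ _ _ _ h1.le le_rfl, zero_add]

/-- The position of the first atom is the threshold in `c` beyond which some weight is positive, and
just beyond it only the first letter has positive weight. Subtracting this atom leaves the weights
of the remaining point on a shorter interval. -/
theorem eq_of_weight_eq (x y : IteratedCone S) (p r : ℝ) (hr : 0 < r)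
    (h : ∀ a c, weight a c x p r = weight a c y p r) : x = y := by
  have hpos : ∀ x y : IteratedCone S, ∀ p r : ℝ, 0 < r →
      (∀ a c, weight a c x p r = weight a c y p r) → firstPosition y ≤ firstPosition x := by
    intro x y p r hr h
    by_contra hlt
    have h1 := weight_pos (p + firstPosition y * r) x p r hr
      (by have := mul_lt_mul_of_pos_right (not_le.1 hlt) hr; linarith)
    rw [h, weight_eq_zero _ _ _ _ _ hr.le le_rfl] at h1
    exact h1.false
  have hlet : ∀ x y : IteratedCone S, ∀ p r : ℝ, 0 < r →
      (∀ a c, weight a c x p r = weight a c y p r) → firstLetter y = firstLetter x := by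
    intro x y p r hr h
    by_contra hne
    obtain ⟨c, hc, h0⟩ := exists_weight_eq_zero (firstLetter x) y hne p r hr
    have hxy : firstPosition x = firstPosition y :=
      le_antisymm (hpos y x p r hr fun a c => (h a c).symm) (hpos x y p r hr h)
    have h1 := weight_pos c x p r hr (by rwa [hxy])
    rw [h, h0] at h1
    exact h1.false
  induction x generalizing y p r with
  | vertex s =>
    have h1 := hpos _ _ p r hr h
    have h1' := hpos _ _ p r hr fun a c => (h a c).symm
    have h2 := hlet _ _ p r hr h
    rcases y with s' | ⟨s', u', y⟩
    · simp only [firstLetter] at h2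
      rw [h2]
    · simp only [firstPosition] at h1'
      linarith [u'.2.2]
  | cone s u x ih =>
    have h1 := hpos _ _ p r hr h
    have h1' := hpos _ _ p r hr fun a c => (h a c).symm
    have h2 := hlet _ _ p r hr h
    rcases y with s' | ⟨s', u', y⟩
    · simp only [firstPosition] at h1
      linarith [u.2.2]
    · simp only [firstPosition, firstLetter] at h1 h1' h2
      obtain rfl : u = u' := Subtype.ext (le_antisymm h1' h1)
      subst h2
      rw [ih y (p + u * r) (r * (1 - u)) (mul_pos hr (by linarith [u.2.2]))]
      intro a c
      have := h a c
      rw [weight, weight] at this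
      exact add_left_cancel this

instance : T2Space (IteratedCone S) := by
  refine T2Space.of_injective_continuous
    (f := fun x : IteratedCone S => fun z : S × ℝ => weight z.1 z.2 x 0 1) ?_
    (continuous_pi fun z => continuous_weight z.1 z.2)
  intro x y h
  exact eq_of_weight_eq x y 0 1 one_pos fun a c => congrFun h (a, c)

end Separation

/-- The cells of the iterated cone. -/
noncomputable def characteristicMaps [Finite S] : CharacteristicMaps (IteratedCone S) where
  cell n := Fin (n + 1) → S
  map := charMap
  continuousOn := continuousOn_charMap
  injective := charMap_injective
  mapsTo n w := by
    refine ⟨⋃ m ∈ Finset.range n, Set.range (Sigma.mk m),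
      Set.Finite.biUnion (Finset.finite_toSet _) fun m _ => Set.finite_range _, fun p hp => ?_⟩
    obtain ⟨m, hm, w', q, hq, h⟩ := exists_charMap_eq (charMap n w p)
    have hlt : m < n := by
      refine lt_of_le_of_ne (hm ▸ dim_charMap_le n w p) fun hd => ?_
      have := mem_ball_of_dim_charMap n w p (hm.trans hd)
      exact (mem_ball_zero_iff.1 this).ne (mem_sphere_zero_iff_norm.1 hp)
    exact ⟨m, hlt, w', Set.mem_biUnion (Finset.mem_coe.2 (Finset.mem_range.2 hlt)) ⟨w', rfl⟩, q,
      ball_subset_closedBall hq, h.symm⟩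
  closed A hA := by
    rw [← isQuotientMap_ofCells.isClosed_preimage, isClosed_sigma_iff]
    rintro ⟨n, w⟩
    have h1 := continuousOn_iff_continuous_domRestrict.1 (continuousOn_charMap n w)
    convert (hA n w).preimage h1 using 1
    ext p
    exact ⟨fun h => ⟨h, p.1, p.2, rfl⟩, fun h => h.1⟩
  surjective x := by
    obtain ⟨n, -, w, p, hp, h⟩ := exists_charMap_eq x
    exact ⟨_, w, p, ball_subset_closedBall hp, h⟩

/-! ### The induced action on the iterated cone and its fixed points. -/

section Action

variable {G : Type u} [Group G] [MulAction G S]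

/-- The action of an element on the points of the iterated cone. -/
def act (g : G) : IteratedCone S → IteratedCone S
  | vertex s => vertex (g • s)
  | cone s u x => cone (g • s) u (act g x)

instance : MulAction G (IteratedCone S) where
  smul := act
  one_smul x := by
    change act 1 x = x
    induction x with
    | vertex s => simp [act]
    | cone s u x ih => simp [act, ih]
  mul_smul g h x := by
    change act (g * h) x = act g (act h x)
    induction x with
    | vertex s => simp [act, mul_smul]
    | cone s u x ih => simp [act, mul_smul, ih]

theorem smul_vertex (g : G) (s : S) : g • vertex s = vertex (g • s) := rfl

theorem smul_cone (g : G) (s : S) (u : Set.Ioo (0 : ℝ) 1) (x : IteratedCone S) :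
    g • cone s u x = cone (g • s) u (g • x) := rfl

theorem smul_coneAt (g : G) (s : S) (u : ℝ) (x : IteratedCone S) :
    g • coneAt s u x = coneAt (g • s) u (g • x) := by
  simp only [coneAt]
  split_ifs <;> rfl

theorem smul_charMap (g : G) (n : ℕ) (w : Fin (n + 1) → S) (p : Fin n → ℝ) :
    g • charMap n w p = charMap n (g • w) p := by
  induction n with
  | zero => rfl
  | succ n ih =>
    rw [charMap, smul_coneAt, ih]
    rfl

instance : ContinuousConstSMul G (IteratedCone S) where
  continuous_const_smul g := by
    refine continuous_of_charMap fun n w => ?_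
    simp only [smul_charMap]
    exact continuousOn_charMap n _

/-- The `G`-CW-structure of the iterated cone on a finite `G`-set. -/
noncomputable def gcwComplex (G : Type u) [Group G] [MulAction G S] [Finite S] :
    GCWComplex G (IteratedCone S) :=
  characteristicMaps.toGCWComplex (fun n => (inferInstance : MulAction G (Fin (n + 1) → S)))
    fun n g i p _ => (smul_charMap g n i p).symm

theorem finiteType_gcwComplex [Finite S] : (gcwComplex (S := S) G).FiniteType := by
  intro n
  have h : Finite (Fin (n + 1) → S) := inferInstance
  have : Finite ((gcwComplex (S := S) G).cell n) := h
  exact Quotient.finite _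

/-- Coning to a vertex fixed by `H` commutes with `H`, so the contraction restricts to the fixed
point set. -/
theorem contractibleSpace_fixedPoints (H : Subgroup G) (s : S) (hs : ∀ h ∈ H, h • s = s) :
    ContractibleSpace (MulAction.fixedPoints H (IteratedCone S)) := by
  rw [contractible_iff_id_nullhomotopic]
  have hv : vertex s ∈ MulAction.fixedPoints H (IteratedCone S) := by
    rintro ⟨h, hh⟩
    exact congrArg vertex (hs h hh)
  have hmem : ∀ (t : ℝ) (x : MulAction.fixedPoints H (IteratedCone S)),
      coneAt s t x.1 ∈ MulAction.fixedPoints H (IteratedCone S) := by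
    rintro t x ⟨h, hh⟩
    change h • coneAt s t x.1 = _
    rw [smul_coneAt, hs h hh]
    exact congrArg _ (x.2 ⟨h, hh⟩)
  refine ⟨⟨vertex s, hv⟩, ⟨⟨⟨fun z => ⟨coneAt s z.1 z.2.1, hmem _ _⟩, ?_⟩, ?_, ?_⟩⟩⟩
  · refine Continuous.subtype_mk ?_ _
    exact (continuous_coneAt s).comp
      ((continuous_subtype_val.comp continuous_snd).prodMk continuous_fst)
  · intro x
    exact Subtype.ext (coneAt_of_nonpos s le_rfl _)
  · intro x
    exact Subtype.ext (coneAt_of_one_le s le_rfl _)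

theorem fixedPoints_eq_empty (H : Subgroup G) (hS : ∀ s : S, ∃ h ∈ H, h • s ≠ s) :
    MulAction.fixedPoints H (IteratedCone S) = ∅ := by
  refine Set.eq_empty_of_forall_notMem fun x hx => ?_
  obtain ⟨h, hh, hne⟩ := hS (firstLetter x)
  have := hx ⟨h, hh⟩
  change h • x = x at this
  rcases x with s | ⟨s, u, x⟩
  · rw [smul_vertex, vertex.injEq] at this
    exact hne this
  · rw [smul_cone, cone.injEq] at this
    exact hne this.1

end Action

end IteratedCone

/-- Reduces the construction of a model to finding a finite `G`-set whose point stabilizers, with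
their subgroups, make up the family. -/
theorem isFiniteTypeModel_iteratedCone {G : Type u} [Group G] (F : SubgroupFamily G) (S : Type v)
    [Finite S] [MulAction G S] (hF : ∀ H, H ∈ F.carrier ↔ ∃ s : S, ∀ h ∈ H, h • s = s) :
    IsFiniteTypeModel F (IteratedCone S) := by
  refine ⟨⟨IteratedCone.gcwComplex G, IteratedCone.finiteType_gcwComplex⟩, fun H hH => ?_,
    fun H hH => ?_⟩
  · obtain ⟨s, hs⟩ := (hF H).1 hH
    exact IteratedCone.contractibleSpace_fixedPoints H s hs
  · refine IteratedCone.fixedPoints_eq_empty H fun s => ?_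
    by_contra! h
    exact hH ((hF H).2 ⟨s, h⟩)

/-- For every nonempty family of subgroups of a finite group there is a model of finite type. -/
theorem exists_isFiniteTypeModel_of_finite {G : Type u} [Group G] [Finite G]
    (F : SubgroupFamily G) :
    ∃ (X : Type v) (_ : TopologicalSpace X) (_ : MulAction G X), IsFiniteTypeModel F X := by
  -- The trivial coset in `G ⧸ H` is fixed by `H`, and the stabilizers in `G ⧸ K` are the conjugates
  -- of `K`. The copy of `Fin n` below only adjusts the universe.
  let S₀ := Σ H : F.carrier, G ⧸ H.1
  have : Finite F.carrier := inferInstance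
  have : Finite S₀ := inferInstance
  obtain ⟨n, ⟨e⟩⟩ := Finite.exists_equiv_fin S₀
  let e' : ULift.{v} (Fin n) ≃ S₀ := Equiv.ulift.trans e.symm
  let _ : MulAction G (ULift.{v} (Fin n)) := e'.mulAction G
  have he : ∀ (g : G) s, e' (g • s) = g • e' s := fun g s => e'.apply_symm_apply _
  refine ⟨IteratedCone (ULift.{v} (Fin n)), inferInstance, inferInstance,
    isFiniteTypeModel_iteratedCone F _ fun H => ⟨fun hH => ?_, ?_⟩⟩
  · refine ⟨e'.symm ⟨⟨H, hH⟩, ((1 : G) : G ⧸ H)⟩, fun h hh => e'.injective ?_⟩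
    rw [he, e'.apply_symm_apply]
    refine Sigma.ext rfl (heq_of_eq ?_)
    change ((h * 1 : G) : G ⧸ H) = ((1 : G) : G ⧸ H)
    rw [QuotientGroup.eq]
    simpa using hh
  · rintro ⟨s, hs⟩
    rcases hes : e' s with ⟨⟨K, hK⟩, x⟩
    induction x using QuotientGroup.induction_on with
    | H g =>
    refine F.le_mem _ (F.conj_mem K hK g) H fun h hh => ?_
    have h1 : h • e' s = e' s := by rw [← he, hs h hh]
    rw [hes] at h1
    have h2 : ((h * g : G) : G ⧸ K) = (g : G ⧸ K) := by
      have := (Sigma.mk.inj h1).2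
      exact eq_of_heq this
    rw [eq_comm, QuotientGroup.eq] at h2
    exact ⟨g⁻¹ * (h * g), h2, by simp [mul_assoc]⟩

/-! ### The join with the integers -/

namespace TopJoin

variable {Y : Type v}

theorem mk_zero (x : ℤ) (y y' : Y) : TopJoin.mk x y 0 = TopJoin.mk x y' 0 :=
  Quot.sound (JoinRel.left x y y')

theorem mk_one (x x' : ℤ) (y : Y) : TopJoin.mk x y 1 = TopJoin.mk x' y 1 :=
  Quot.sound (JoinRel.right x x' y)

/-- The join coordinate. -/
def height (z : TopJoin ℤ Y) : unitInterval :=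
  Quot.lift (fun p : ℤ × Y × unitInterval => p.2.2)
    (by rintro _ _ (⟨a, b, b'⟩ | ⟨a, a', b⟩) <;> rfl) z

/-- The points with a second coordinate in `U`. -/
def rightSet (U : Set Y) : Set (TopJoin ℤ Y) :=
  {z | Quot.lift (fun p : ℤ × Y × unitInterval => p.2.1 ∈ U ∧ 0 < p.2.2)
    (by rintro _ _ (⟨a, b, b'⟩ | ⟨a, a', b⟩) <;> simp) z}

/-- The points with a first coordinate in `B`. -/
def leftSet (Y : Type v) (B : Set ℤ) : Set (TopJoin ℤ Y) :=
  {z | Quot.lift (fun p : ℤ × Y × unitInterval => p.1 ∈ B ∧ p.2.2 < 1)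
    (by rintro _ _ (⟨a, b, b'⟩ | ⟨a, a', b⟩) <;> simp) z}

@[simp] theorem height_mk (x : ℤ) (y : Y) (q : unitInterval) :
    height (TopJoin.mk x y q) = q := rfl

theorem height_eq_of_mk_eq {x x' : ℤ} {y y' : Y} {q q' : unitInterval}
    (h : TopJoin.mk x y q = TopJoin.mk x' y' q') : q = q' := congrArg height h

theorem right_eq_of_mk_eq {x x' : ℤ} {y y' : Y} {q q' : unitInterval}
    (h : TopJoin.mk x y q = TopJoin.mk x' y' q') (hq : 0 < q) : y = y' := by
  have h1 : TopJoin.mk x y q ∈ rightSet {y} := ⟨rfl, hq⟩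
  rw [h] at h1
  exact h1.1.symm

theorem left_eq_of_mk_eq {x x' : ℤ} {y y' : Y} {q q' : unitInterval}
    (h : TopJoin.mk x y q = TopJoin.mk x' y' q') (hq : q < 1) : x = x' := by
  have h1 : TopJoin.mk x y q ∈ leftSet Y {x} := ⟨rfl, hq⟩
  rw [h] at h1
  exact h1.1.symm

variable [TopologicalSpace Y]

theorem isQuotientMap_mk :
    IsQuotientMap fun p : ℤ × Y × unitInterval => TopJoin.mk p.1 p.2.1 p.2.2 :=
  isQuotientMap_quot_mk

theorem continuous_mk (x : ℤ) :
    Continuous fun p : Y × unitInterval => TopJoin.mk x p.1 p.2 :=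
  isQuotientMap_mk.continuous.comp (continuous_const.prodMk continuous_id)

theorem continuous_height : Continuous (height (Y := Y)) :=
  isQuotientMap_mk.continuous_iff.2 (continuous_snd.comp continuous_snd)

theorem isOpen_rightSet {U : Set Y} (hU : IsOpen U) : IsOpen (rightSet U) := by
  rw [← isQuotientMap_mk.isOpen_preimage]
  have h : IsOpen {p : ℤ × Y × unitInterval | p.2.1 ∈ U ∧ 0 < p.2.2} :=
    (hU.preimage (continuous_fst.comp continuous_snd)).inter
      (isOpen_lt (by fun_prop) (by fun_prop))
  exact h

theorem isOpen_leftSet (B : Set ℤ) : IsOpen (leftSet Y B) := by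
  rw [← isQuotientMap_mk.isOpen_preimage]
  have h : IsOpen {p : ℤ × Y × unitInterval | p.1 ∈ B ∧ p.2.2 < 1} :=
    ((isOpen_discrete B).preimage continuous_fst).inter
      (isOpen_lt (by fun_prop) (by fun_prop))
  exact h

/-- Points of different height are separated by `height`; at equal height, by the integer coordinate
if `q < 1` or by the coordinate in `Y` if `q > 0`. -/
instance [T2Space Y] : T2Space (TopJoin ℤ Y) where
  t2 := by
    refine TopJoin.ind fun x y q => TopJoin.ind fun x' y' q' => fun hne => ?_
    by_cases hq : q = q'
    · subst hq
      by_cases h1 : x ≠ x' ∧ q < 1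
      · refine ⟨leftSet Y {x}, leftSet Y {x'}, isOpen_leftSet _, isOpen_leftSet _, ⟨rfl, h1.2⟩,
          ⟨rfl, h1.2⟩, Set.disjoint_left.2 (TopJoin.ind fun a b r ha hb => h1.1 ?_)⟩
        exact ha.1.symm.trans hb.1
      by_cases h2 : y ≠ y' ∧ 0 < q
      · obtain ⟨U, V, hU, hV, hyU, hyV, hd⟩ := t2_separation h2.1
        refine ⟨rightSet U, rightSet V, isOpen_rightSet hU, isOpen_rightSet hV, ⟨hyU, h2.2⟩,
          ⟨hyV, h2.2⟩, Set.disjoint_left.2 (TopJoin.ind fun a b r ha hb => ?_)⟩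
        exact Set.disjoint_left.1 hd ha.1 hb.1
      refine (hne ?_).elim
      by_cases hq1 : q = 1
      · subst hq1
        have hy : y = y' := by
          by_contra h
          exact h2 ⟨h, zero_lt_one⟩
        rw [hy, mk_one x x']
      · have hx : x = x' := by
          by_contra h
          exact h1 ⟨h, lt_of_le_of_ne q.2.2 hq1⟩
        subst hx
        by_cases hq0 : q = 0
        · subst hq0
          exact mk_zero x y y'
        · have hy : y = y' := by
            by_contra h
            exact h2 ⟨h, lt_of_le_of_ne q.2.1 (Ne.symm hq0)⟩
          rw [hy]
    · exact separated_by_continuous continuous_height hq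

theorem isClosedEmbedding_mk_one :
    IsClosedEmbedding fun y : Y => TopJoin.mk (0 : ℤ) y 1 := by
  refine IsClosedEmbedding.of_continuous_injective_isClosedMap
    ((continuous_mk 0).comp (continuous_id.prodMk continuous_const))
    (fun y y' h => right_eq_of_mk_eq h zero_lt_one) fun C hC => ?_
  rw [← isQuotientMap_mk.isClosed_preimage]
  have h1 : IsClosed {p : ℤ × Y × unitInterval | p.2.1 ∈ C ∧ p.2.2 = 1} :=
    (hC.preimage (continuous_fst.comp continuous_snd)).inter
      (isClosed_eq (continuous_snd.comp continuous_snd) continuous_const)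
  convert h1 using 1
  ext ⟨x, y, q⟩
  constructor
  · rintro ⟨y', hy', h⟩
    have h2 : (1 : unitInterval) = q := height_eq_of_mk_eq h
    have h3 : y' = y := right_eq_of_mk_eq h zero_lt_one
    exact ⟨h3 ▸ hy', h2.symm⟩
  · rintro ⟨hy, hq⟩
    have hq' : q = 1 := hq
    subst hq'
    exact ⟨y, hy, mk_one 0 x y⟩

/-- The homotopy `f₁` contracts the coordinate in `Y` to `y₀`; then `f₂` slides along the join
coordinate to 1, where the integer coordinate is forgotten. -/
theorem contractibleSpace [ContractibleSpace Y] : ContractibleSpace (TopJoin ℤ Y) := by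
  obtain ⟨y₀, ⟨H⟩⟩ := id_nullhomotopic Y
  have hq : ∀ g : TopJoin ℤ Y × unitInterval → TopJoin ℤ Y,
      (∀ x : ℤ, Continuous fun p : (Y × unitInterval) × unitInterval =>
        g (TopJoin.mk x p.1.1 p.1.2, p.2)) → Continuous g := by
    intro g hg
    refine isQuotientMap_mk.continuous_lift_prod_left ?_
    have h1 : Continuous fun p : ℤ × ((Y × unitInterval) × unitInterval) =>
        g (TopJoin.mk p.1 p.2.1.1 p.2.1.2, p.2.2) :=
      continuous_prod_of_discrete_left.2 hg
    exact h1.comp (f := fun p : (ℤ × Y × unitInterval) × unitInterval =>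
      (p.1.1, (p.1.2, p.2))) (by fun_prop)
  let f₁ : TopJoin ℤ Y × unitInterval → TopJoin ℤ Y := fun p =>
    Quot.lift (fun a : ℤ × Y × unitInterval => TopJoin.mk a.1 (H (p.2, a.2.1)) a.2.2) (by
      rintro _ _ (⟨a, b, b'⟩ | ⟨a, a', b⟩)
      · exact mk_zero _ _ _
      · exact mk_one _ _ _) p.1
  let f₂ : TopJoin ℤ Y × unitInterval → TopJoin ℤ Y := fun p =>
    Quot.lift (fun a : ℤ × Y × unitInterval => TopJoin.mk a.1 y₀ (max a.2.2 p.2)) (by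
      rintro _ _ (⟨a, b, b'⟩ | ⟨a, a', b⟩)
      · rfl
      · have : max (1 : unitInterval) p.2 = 1 := max_eq_left unitInterval.le_one'
        simp only [this]
        exact mk_one _ _ _) p.1
  have hf₁ : Continuous f₁ := hq _ fun x => (continuous_mk x).comp
    (f := fun p : (Y × unitInterval) × unitInterval => (H (p.2, p.1.1), p.1.2)) (by fun_prop)
  have hf₂ : Continuous f₂ := hq _ fun x => (continuous_mk x).comp
    (f := fun p : (Y × unitInterval) × unitInterval => (y₀, max p.1.2 p.2)) (by fun_prop)
  have hf₁' : ∀ x y q t, f₁ (TopJoin.mk x y q, t) = TopJoin.mk x (H (t, y)) q :=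
    fun _ _ _ _ => rfl
  have hf₂' : ∀ x y q t, f₂ (TopJoin.mk x y q, t) = TopJoin.mk x y₀ (max q t) :=
    fun _ _ _ _ => rfl
  rw [contractible_iff_id_nullhomotopic]
  refine ⟨TopJoin.mk 0 y₀ 1, ContinuousMap.Homotopic.trans
    (g := ⟨fun z => f₁ (z, 1), hf₁.comp (continuous_id.prodMk continuous_const)⟩)
    ⟨⟨⟨fun p => f₁ (p.2, p.1), hf₁.comp continuous_swap⟩, ?_, fun _ => rfl⟩⟩
    ⟨⟨⟨fun p => f₂ (p.2, p.1), hf₂.comp continuous_swap⟩, ?_, ?_⟩⟩⟩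
  · refine TopJoin.ind fun x y q => ?_
    change f₁ (TopJoin.mk x y q, 0) = TopJoin.mk x y q
    rw [hf₁', H.apply_zero]
    rfl
  · refine TopJoin.ind fun x y q => ?_
    change f₂ (TopJoin.mk x y q, 0) = f₁ (TopJoin.mk x y q, 1)
    rw [hf₁', hf₂', H.apply_one, max_eq_left unitInterval.nonneg']
    rfl
  · refine TopJoin.ind fun x y q => ?_
    change f₂ (TopJoin.mk x y q, 1) = TopJoin.mk 0 y₀ 1
    rw [hf₂', max_eq_right unitInterval.le_one']
    exact mk_one _ _ _

end TopJoin

/-! ### The cells of the join with the integers -/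

/-- The cells of the join of the integers with a CW complex with cells `C`. -/
inductive JoinCell (C : ℕ → Type v) : ℕ → Type v
  | base {n : ℕ} (i : C n) : JoinCell C n
  | tip (x : ℤ) : JoinCell C 0
  | cone {n : ℕ} (x : ℤ) (i : C n) : JoinCell C (n + 1)

/-- The coordinate in the unit interval of a coordinate in `[-1, 1]`. -/
noncomputable def halfShift (r : ℝ) : unitInterval := Set.projIcc 0 1 zero_le_one ((r + 1) / 2)

theorem continuous_halfShift : Continuous halfShift :=
  continuous_projIcc.comp (by fun_prop)

theorem coe_halfShift {r : ℝ} (hr : r ∈ Set.Icc (-1 : ℝ) 1) : (halfShift r : ℝ) = (r + 1) / 2 := by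
  rw [halfShift, Set.projIcc_of_mem zero_le_one (x := (r + 1) / 2)
    ⟨by linarith [hr.1], by linarith [hr.2]⟩]

theorem halfShift_two_mul_sub (q : unitInterval) : halfShift (2 * q - 1) = q := by
  refine Subtype.ext ?_
  rw [coe_halfShift ⟨by linarith [q.2.1], by linarith [q.2.2]⟩]
  ring

theorem halfShift_pos {r : ℝ} (hr : r ∈ Set.Ioo (-1 : ℝ) 1) : 0 < halfShift r := by
  rw [← Subtype.coe_lt_coe, coe_halfShift ⟨hr.1.le, hr.2.le⟩]
  simp only [Set.Icc.coe_zero]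
  linarith [hr.1]

theorem halfShift_lt_one {r : ℝ} (hr : r ∈ Set.Ioo (-1 : ℝ) 1) : halfShift r < 1 := by
  rw [← Subtype.coe_lt_coe, coe_halfShift ⟨hr.1.le, hr.2.le⟩]
  simp only [Set.Icc.coe_one]
  linarith [hr.2]

namespace TopJoin

open RelCWComplex

variable {Y : Type v} [TopologicalSpace Y] [CWComplex (Set.univ : Set Y)]

/-- The characteristic maps of the join of the integers with `Y`. -/
noncomputable def charMap (y₀ : Y) :
    ∀ n, JoinCell (cell (Set.univ : Set Y)) n → (Fin n → ℝ) → TopJoin ℤ Y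
  | _, .base i, p => TopJoin.mk 0 (RelCWComplex.map _ i p) 1
  | _, .tip x, _ => TopJoin.mk x y₀ 0
  | _, .cone x i, p => TopJoin.mk x (RelCWComplex.map _ i (Fin.tail p)) (halfShift (p 0))

theorem charMap_cone_cons (y₀ : Y) {n : ℕ} (x : ℤ) (i : cell (Set.univ : Set Y) n) (p : Fin n → ℝ)
    (q : unitInterval) :
    charMap y₀ (n + 1) (.cone x i) (Fin.cons (2 * (q : ℝ) - 1) p) =
      TopJoin.mk x (RelCWComplex.map n i p) q := by
  rw [charMap, Fin.tail_cons, Fin.cons_zero, halfShift_two_mul_sub]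

theorem cons_mem_closedBall {n : ℕ} {p : Fin n → ℝ} (hp : p ∈ closedBall 0 1) (q : unitInterval) :
    (Fin.cons (2 * (q : ℝ) - 1) p : Fin (n + 1) → ℝ) ∈ closedBall 0 1 := by
  rw [mem_closedBall_succ_iff, Fin.cons_zero, Fin.tail_cons]
  exact ⟨⟨by linarith [q.2.1], by linarith [q.2.2]⟩, hp⟩

theorem continuousOn_charMap (y₀ : Y) (n : ℕ) (i : JoinCell (cell (Set.univ : Set Y)) n) :
    ContinuousOn (charMap y₀ n i) (closedBall 0 1) := by
  rcases i with i | x | ⟨x, i⟩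
  · exact (continuous_mk 0).comp_continuousOn
      ((RelCWComplex.continuousOn n i).prodMk continuousOn_const)
  · exact continuousOn_const
  · refine (continuous_mk x).comp_continuousOn (ContinuousOn.prodMk ?_ ?_)
    · exact (RelCWComplex.continuousOn _ i).comp (continuous_finTail _).continuousOn
        fun p hp => ((mem_closedBall_succ_iff p).1 hp).2
    · exact (continuous_halfShift.comp (continuous_apply 0)).continuousOn

theorem charMap_injective (y₀ : Y) (n m : ℕ) (i : JoinCell (cell (Set.univ : Set Y)) n)
    (j : JoinCell (cell (Set.univ : Set Y)) m) (p : Fin n → ℝ) (hp : p ∈ ball 0 1)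
    (q : Fin m → ℝ) (hq : q ∈ ball 0 1) (h : charMap y₀ n i p = charMap y₀ m j q) :
    (⟨n, i, p⟩ : Σ n, JoinCell (cell (Set.univ : Set Y)) n × (Fin n → ℝ)) = ⟨m, j, q⟩ := by
  have hh := congrArg height h
  rcases i with i | x | ⟨x, i⟩ <;> rcases j with j | x' | ⟨x', j⟩ <;>
    simp only [charMap, height_mk] at h hh
  · have h1 := map_ball_injective hp hq (right_eq_of_mk_eq h zero_lt_one)
    cases h1
    rfl
  · exact (zero_ne_one hh.symm).elim
  · exact ((halfShift_lt_one ((mem_ball_succ_iff q).1 hq).1).ne hh.symm).elim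
  · exact (zero_ne_one hh).elim
  · obtain rfl := left_eq_of_mk_eq h zero_lt_one
    rw [Subsingleton.elim p q]
  · exact ((halfShift_pos ((mem_ball_succ_iff q).1 hq).1).ne hh).elim
  · exact ((halfShift_lt_one ((mem_ball_succ_iff p).1 hp).1).ne hh).elim
  · exact ((halfShift_pos ((mem_ball_succ_iff p).1 hp).1).ne' hh).elim
  · obtain ⟨hp0, hp'⟩ := (mem_ball_succ_iff p).1 hp
    obtain ⟨hq0, hq'⟩ := (mem_ball_succ_iff q).1 hq
    have h1 := map_ball_injective hp' hq' (right_eq_of_mk_eq h (halfShift_pos hp0))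
    obtain rfl := left_eq_of_mk_eq h (halfShift_lt_one hp0)
    have h2 : p 0 = q 0 := by
      have := congrArg Subtype.val hh
      rw [coe_halfShift ⟨hp0.1.le, hp0.2.le⟩, coe_halfShift ⟨hq0.1.le, hq0.2.le⟩] at this
      linarith
    have key : ∀ (n m : ℕ) (i : cell (Set.univ : Set Y) n) (j : cell (Set.univ : Set Y) m)
        (p' : Fin n → ℝ) (q' : Fin m → ℝ) (a b : ℝ), a = b →
        (⟨n, i, p'⟩ : Σ n, cell (Set.univ : Set Y) n × (Fin n → ℝ)) = ⟨m, j, q'⟩ →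
        (⟨n + 1, .cone x i, Fin.cons a p'⟩ :
          Σ n, JoinCell (cell (Set.univ : Set Y)) n × (Fin n → ℝ)) =
            ⟨m + 1, .cone x j, Fin.cons b q'⟩ := by
      rintro n m i j p' q' a b rfl h
      cases h
      rfl
    have := key _ _ i j _ _ _ _ h2 h1
    rwa [Fin.cons_self_tail, Fin.cons_self_tail] at this

theorem exists_finite_charMap_sphere (y₀ : Y) (n : ℕ)
    (i : JoinCell (cell (Set.univ : Set Y)) n) :
    ∃ T : Set (Σ m, JoinCell (cell (Set.univ : Set Y)) m), T.Finite ∧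
      ∀ p ∈ sphere (0 : Fin n → ℝ) 1, ∃ m < n, ∃ j, ⟨m, j⟩ ∈ T ∧
        ∃ q ∈ closedBall (0 : Fin m → ℝ) 1, charMap y₀ n i p = charMap y₀ m j q := by
  have hY : ∀ n (i : cell (Set.univ : Set Y) n), ∃ T : Set (Σ m, cell (Set.univ : Set Y) m),
      T.Finite ∧ ∀ p ∈ sphere (0 : Fin n → ℝ) 1, ∃ m < n, ∃ j, ⟨m, j⟩ ∈ T ∧
        ∃ q ∈ closedBall (0 : Fin m → ℝ) 1, RelCWComplex.map n i p = RelCWComplex.map m j q := by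
    intro n i
    obtain ⟨I, hI⟩ := CWComplex.mapsTo n i
    refine ⟨⋃ m ∈ Finset.range n, Sigma.mk m '' (I m : Set (cell (Set.univ : Set Y) m)),
      Set.Finite.biUnion (Finset.finite_toSet _) fun m _ => (Finset.finite_toSet _).image _,
      fun p hp => ?_⟩
    have := hI hp
    simp only [Set.mem_iUnion] at this
    obtain ⟨m, hm, j, hj, q, hq, h⟩ := this
    exact ⟨m, hm, j, Set.mem_biUnion (Finset.mem_coe.2 (Finset.mem_range.2 hm)) ⟨j, hj, rfl⟩, q,
      hq, h.symm⟩
  rcases i with i | x | @⟨n, x, i⟩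
  · obtain ⟨T, hT, h⟩ := hY n i
    refine ⟨(fun z => ⟨z.1, .base z.2⟩) '' T, hT.image _, fun p hp => ?_⟩
    obtain ⟨m, hm, j, hj, q, hq, h'⟩ := h p hp
    refine ⟨m, hm, .base j, ⟨_, hj, rfl⟩, q, hq, ?_⟩
    rw [charMap, charMap, h']
  · refine ⟨∅, Set.finite_empty, fun p hp => ?_⟩
    have := mem_sphere_zero_iff_norm.1 hp
    rw [Subsingleton.elim p 0, norm_zero] at this
    exact (zero_ne_one this).elim
  · obtain ⟨T, hT, h⟩ := hY n i
    -- One end face collapses to the integer `x`, the other is the cell `i` of `Y`, and the side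
    -- faces are swept out by the boundary of `i`.
    refine ⟨insert ⟨0, .tip x⟩ (insert ⟨n, .base i⟩ ((fun z => ⟨z.1 + 1, .cone x z.2⟩) '' T)),
      ((hT.image _).insert _).insert _, fun p hp => ?_⟩
    obtain ⟨h0, ht⟩ := (mem_closedBall_succ_iff p).1 (sphere_subset_closedBall hp)
    rcases h0.1.eq_or_lt with h1 | h1
    · refine ⟨0, n.succ_pos, .tip x, Set.mem_insert _ _, 0, by simp, ?_⟩
      have : halfShift (p 0) = 0 := by
        refine Subtype.ext ?_
        rw [coe_halfShift h0, ← h1]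
        simp
      rw [charMap, charMap, this]
      exact mk_zero _ _ _
    rcases h0.2.eq_or_lt with h2 | h2
    · refine ⟨n, n.lt_succ_self, .base i, Set.mem_insert_of_mem _ (Set.mem_insert _ _), _, ht, ?_⟩
      have : halfShift (p 0) = 1 := by
        refine Subtype.ext ?_
        rw [coe_halfShift h0, h2]
        simp
      rw [charMap, charMap, this]
      exact mk_one _ _ _
    · have hts : (Fin.tail p : Fin n → ℝ) ∈ sphere 0 1 := by
        by_contra hcon
        rw [← ball_union_sphere] at ht
        have := (mem_ball_succ_iff p).2 ⟨⟨h1, h2⟩, ht.resolve_right hcon⟩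
        exact (mem_ball_zero_iff.1 this).ne (mem_sphere_zero_iff_norm.1 hp)
      obtain ⟨m, hm, j, hj, q, hq, h'⟩ := h _ hts
      refine ⟨m + 1, Nat.succ_lt_succ hm, .cone x j, Set.mem_insert_of_mem _
        (Set.mem_insert_of_mem _ ⟨_, hj, rfl⟩), Fin.cons (p 0) q, ?_, ?_⟩
      · rw [mem_closedBall_succ_iff, Fin.cons_zero, Fin.tail_cons]
        exact ⟨h0, hq⟩
      · rw [charMap, charMap, Fin.cons_zero, Fin.tail_cons, h']

/-- Both quotient maps, from ℤ × Y × [0, 1] to the join and from the closed cells of `Y` times [0,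
1], detect closed sets; the second is a quotient map by compactness of the interval. -/
theorem isClosed_of_charMap [T2Space Y] (y₀ : Y) (A : Set (TopJoin ℤ Y))
    (hA : ∀ n i, IsClosed (A ∩ charMap y₀ n i '' closedBall 0 1)) : IsClosed A := by
  rw [← isOpen_compl_iff, ← isQuotientMap_mk.isOpen_preimage, isOpen_iff_continuous_mem,
    continuous_prod_of_discrete_left]
  intro x
  refine (isQuotientMap_closedCells (X := Y)).continuous_lift_prod_left
    (g := fun p : Y × unitInterval => TopJoin.mk x p.1 p.2 ∈ Aᶜ) (continuous_sigma_prod ?_)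
  rintro ⟨n, i⟩
  rw [continuous_Prop, ← isClosed_compl_iff]
  have h1 : Continuous fun q : closedBall (0 : Fin n → ℝ) 1 × unitInterval =>
      TopJoin.mk x (RelCWComplex.map (C := (Set.univ : Set Y)) n i q.1.1) q.2 := by
    refine (continuous_mk x).comp (Continuous.prodMk ?_ continuous_snd)
    exact (continuousOn_iff_continuous_domRestrict.1
      (RelCWComplex.continuousOn (C := (Set.univ : Set Y)) n i)).comp continuous_fst
  convert (hA (n + 1) (.cone x i)).preimage h1 using 1
  ext q
  constructor
  · intro h
    refine ⟨not_not.1 h, Fin.cons (2 * (q.2 : ℝ) - 1) q.1.1, cons_mem_closedBall q.1.2 q.2, ?_⟩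
    exact charMap_cone_cons y₀ x i q.1.1 q.2
  · intro h
    exact not_not.2 h.1

/-- The cells of the join of the integers with `Y`. -/
noncomputable def characteristicMaps [T2Space Y] (y₀ : Y) :
    CharacteristicMaps (TopJoin ℤ Y) where
  cell := JoinCell (cell (Set.univ : Set Y))
  map := charMap y₀
  continuousOn := continuousOn_charMap y₀
  injective := charMap_injective y₀
  mapsTo := exists_finite_charMap_sphere y₀
  closed := isClosed_of_charMap y₀
  surjective := by
    refine TopJoin.ind fun x y q => ?_
    obtain ⟨n, i, p, hp, rfl⟩ := exists_map_ball_eq y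
    exact ⟨n + 1, .cone x i, _, cons_mem_closedBall (ball_subset_closedBall hp) q,
      charMap_cone_cons y₀ x i p q⟩

end TopJoin

/-! ### The action of the infinite dihedral group on the join -/

theorem dihedralOnInt_mul (g h : DihedralGroup 0) (x : ℤ) :
    dihedralOnInt (g * h) x = dihedralOnInt g (dihedralOnInt h x) := by
  rcases g with i | i <;> rcases h with j | j <;> simp [dihedralOnInt] <;> ring

theorem dihedralOnInt_one (x : ℤ) : dihedralOnInt 1 x = x := by
  change x + 2 * ((0 : ZMod 0).cast : ℤ) = x
  simp

theorem dihedralSign_mul (g h : DihedralGroup 0) :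
    dihedralSign (g * h) = dihedralSign g * dihedralSign h := by
  rcases g with i | i <;> rcases h with j | j <;> (simp [dihedralSign]; try decide)

theorem dihedralSign_one : dihedralSign 1 = 1 := rfl

theorem finite_of_finite_orbitRel_quotient {K α : Type*} [Group K] [Finite K] [MulAction K α]
    (h : Finite (MulAction.orbitRel.Quotient K α)) : Finite α := by
  refine Finite.of_surjective
    (fun z : K × MulAction.orbitRel.Quotient K α => z.1 • (Quotient.out z.2 : α)) fun a => ?_
  have h1 : MulAction.orbitRel K α a (Quotient.out (Quotient.mk (MulAction.orbitRel K α) a)) :=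
    (MulAction.orbitRel K α).iseqv.symm (@Quotient.mk_out _ (MulAction.orbitRel K α) a)
  obtain ⟨k, hk⟩ := MulAction.orbitRel_apply.1 h1
  exact ⟨(k, _), hk⟩

theorem finite_orbitRel_quotient_of_finite_set {K α : Type*} [Group K] [MulAction K α] {T : Set α}
    (hT : T.Finite) (h : ∀ a : α, ∃ k : K, k • a ∈ T) :
    Finite (MulAction.orbitRel.Quotient K α) := by
  have := hT.to_subtype
  refine Finite.of_surjective
    (fun t : T => (Quotient.mk (MulAction.orbitRel K α) t.1 : MulAction.orbitRel.Quotient K α))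
    fun z => ?_
  induction z using Quotient.inductionOn with
  | h a =>
  obtain ⟨k, hk⟩ := h a
  exact ⟨⟨_, hk⟩, Quotient.sound (s := MulAction.orbitRel K α) ⟨k, rfl⟩⟩

namespace JoinCell

variable {C : ℕ → Type v} [∀ n, MulAction (Multiplicative (ZMod 2)) (C n)]

/-- The action of an element of the infinite dihedral group on the cells of the join. -/
def act (g : DihedralGroup 0) : ∀ {n : ℕ}, JoinCell C n → JoinCell C n
  | _, .base i => .base (dihedralSign g • i)
  | _, .tip x => .tip (dihedralOnInt g x)
  | _, .cone x i => .cone (dihedralOnInt g x) (dihedralSign g • i)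

instance (n : ℕ) : MulAction (DihedralGroup 0) (JoinCell C n) where
  smul g i := act g i
  one_smul i := by
    change act 1 i = i
    rcases i with i | x | ⟨x, i⟩ <;> simp [act, dihedralSign_one, dihedralOnInt_one]
  mul_smul g h i := by
    change act (g * h) i = act g (act h i)
    rcases i with i | x | ⟨x, i⟩ <;> simp [act, dihedralSign_mul, dihedralOnInt_mul, mul_smul]

theorem finite_orbits (hC : ∀ n, Finite (C n)) (n : ℕ) :
    Finite (MulAction.orbitRel.Quotient (DihedralGroup 0) (JoinCell C n)) := by
  -- A power of t moves every integer to its remainder modulo 2.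
  have hx : ∀ x : ℤ, dihedralOnInt (.r ((-(x / 2) : ℤ) : ZMod 0)) x = x % 2 := by
    intro x
    have : (((-(x / 2) : ℤ) : ZMod 0).cast : ℤ) = -(x / 2) := by simp
    change x + 2 * (((-(x / 2) : ℤ) : ZMod 0).cast : ℤ) = x % 2
    rw [this]
    omega
  have hx' : ∀ x : ℤ, ∃ b : Fin 2, x % 2 = (b : ℕ) := by
    intro x
    rcases Int.emod_two_eq_zero_or_one x with h | h
    · exact ⟨0, by simpa using h⟩
    · exact ⟨1, by simpa using h⟩
  rcases n with _ | n
  · refine finite_orbitRel_quotient_of_finite_set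
      (T := Set.range (base (C := C) (n := 0)) ∪ Set.range fun b : Fin 2 => tip ((b : ℕ) : ℤ))
      ((Set.finite_range _).union (Set.finite_range _)) fun i => ?_
    rcases i with i | x
    · exact ⟨1, Or.inl ⟨i, by rw [one_smul]⟩⟩
    · obtain ⟨b, hb⟩ := hx' x
      refine ⟨.r ((-(x / 2) : ℤ) : ZMod 0), Or.inr ⟨b, ?_⟩⟩
      change tip ((b : ℕ) : ℤ) = tip (dihedralOnInt _ x)
      rw [← hb, hx x]
  · refine finite_orbitRel_quotient_of_finite_set
      (T := Set.range (base (C := C) (n := n + 1)) ∪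
        Set.range fun z : Fin 2 × C n => cone ((z.1 : ℕ) : ℤ) z.2)
      ((Set.finite_range _).union (Set.finite_range _)) fun i => ?_
    rcases i with i | _ | ⟨x, i⟩
    · exact ⟨1, Or.inl ⟨i, by rw [one_smul]⟩⟩
    · obtain ⟨b, hb⟩ := hx' x
      refine ⟨.r ((-(x / 2) : ℤ) : ZMod 0), Or.inr ⟨(b, i), ?_⟩⟩
      change cone ((b : ℕ) : ℤ) i = cone (dihedralOnInt _ x) ((1 : Multiplicative (ZMod 2)) • i)
      rw [← hb, hx x, one_smul]

end JoinCell

namespace TopJoin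

variable {Y : Type v} [MulAction (Multiplicative (ZMod 2)) Y]

theorem smul_mk (g : DihedralGroup 0) (x : ℤ) (y : Y) (q : unitInterval) :
    g • TopJoin.mk x y q = TopJoin.mk (dihedralOnInt g x) (dihedralSign g • y) q := rfl

variable [TopologicalSpace Y]

theorem continuousConstSMul [ContinuousConstSMul (Multiplicative (ZMod 2)) Y] :
    ContinuousConstSMul (DihedralGroup 0) (TopJoin ℤ Y) where
  continuous_const_smul g := by
    rw [isQuotientMap_mk.continuous_iff]
    refine continuous_prod_of_discrete_left.2 fun x => ?_
    exact (continuous_mk (dihedralOnInt g x)).comp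
      (((continuous_const_smul (dihedralSign g)).comp continuous_fst).prodMk continuous_snd)

theorem exists_gcwComplex_finiteType (c : GCWComplex (Multiplicative (ZMod 2)) Y)
    (hc : c.FiniteType) (y₀ : Y) :
    ∃ c' : GCWComplex (DihedralGroup 0) (TopJoin ℤ Y), c'.FiniteType := by
  let _ := c.toCWComplex
  have := c.t2Space
  have := c.continuousConstSMul
  have := continuousConstSMul (Y := Y)
  let _ : ∀ n, MulAction (Multiplicative (ZMod 2)) (RelCWComplex.cell (Set.univ : Set Y) n) :=
    c.cellAction
  let D := characteristicMaps y₀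
  let act : ∀ n, MulAction (DihedralGroup 0) (D.cell n) := fun n =>
    (inferInstance :
      MulAction (DihedralGroup 0) (JoinCell (RelCWComplex.cell (Set.univ : Set Y)) n))
  have hmap : ∀ n (g : Multiplicative (ZMod 2)) (i : RelCWComplex.cell (Set.univ : Set Y) n),
      ∀ p ∈ closedBall (0 : Fin n → ℝ) 1,
      RelCWComplex.map n (g • i) p = g • RelCWComplex.map n i p := c.map_smul
  refine ⟨D.toGCWComplex act ?_, fun n => ?_⟩
  · intro n g i p hp
    rcases i with i | x | ⟨x, i⟩
    · change TopJoin.mk 0 (RelCWComplex.map n (dihedralSign g • i) p) 1 =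
        TopJoin.mk _ (dihedralSign g • RelCWComplex.map n i p) 1
      rw [hmap n _ i p hp]
      exact mk_one _ _ _
    · exact mk_zero _ _ _
    · change TopJoin.mk _ (RelCWComplex.map _ (dihedralSign g • i) (Fin.tail p)) _ =
        TopJoin.mk _ (dihedralSign g • RelCWComplex.map _ i (Fin.tail p)) _
      rw [hmap _ _ i _ ((mem_closedBall_succ_iff p).1 hp).2]
  · exact JoinCell.finite_orbits (C := RelCWComplex.cell (Set.univ : Set Y))
      (fun n => finite_of_finite_orbitRel_quotient (hc n)) n

end TopJoin

/-! ### Fixed points of the join -/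

theorem mem_zpowers_r_one (i : ZMod 0) :
    DihedralGroup.r i ∈ Subgroup.zpowers (DihedralGroup.r 1 : DihedralGroup 0) :=
  Subgroup.mem_zpowers_iff.2 ⟨(i.cast : ℤ), by simp⟩

theorem isCyclic_of_le_zpowers {G : Type u} [Group G] {H : Subgroup G} {g : G}
    (h : H ≤ Subgroup.zpowers g) : IsCyclic H :=
  isCyclic_of_injective (Subgroup.inclusion h) (Subgroup.inclusion_injective h)

/-- A cyclic subgroup of `D_∞` containing a reflection has order two. -/
theorem eq_one_or_eq_sr_of_isCyclic {H : Subgroup (DihedralGroup 0)} (hH : IsCyclic H)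
    {i : ZMod 0} (hi : DihedralGroup.sr i ∈ H) {g : DihedralGroup 0} (hg : g ∈ H) :
    g = 1 ∨ g = .sr i := by
  obtain ⟨⟨a, ha⟩, hgen⟩ := hH.exists_generator
  have hpow : ∀ b ∈ H, ∃ k : ℤ, a ^ k = b := by
    intro b hb
    obtain ⟨k, hk⟩ := Subgroup.mem_zpowers_iff.1 (hgen ⟨b, hb⟩)
    exact ⟨k, congrArg Subtype.val hk⟩
  rcases a with j | j
  · obtain ⟨k, hk⟩ := hpow _ hi
    simp at hk
  · have hsq : (DihedralGroup.sr j : DihedralGroup 0) ^ (2 : ℤ) = 1 := by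
      rw [zpow_ofNat, pow_two, DihedralGroup.sr_mul_self]
    have hpow' : ∀ k : ℤ, (DihedralGroup.sr j : DihedralGroup 0) ^ k = 1 ∨
        (DihedralGroup.sr j : DihedralGroup 0) ^ k = .sr j := by
      intro k
      rcases Int.even_or_odd' k with ⟨m, rfl | rfl⟩
      · left; rw [zpow_mul, hsq, one_zpow]
      · right; rw [zpow_add, zpow_mul, hsq, one_zpow, one_mul, zpow_one]
    obtain ⟨k, hk⟩ := hpow _ hi
    obtain ⟨l, rfl⟩ := hpow _ hg
    have hij : DihedralGroup.sr i = DihedralGroup.sr j := by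
      rcases hpow' k with h | h
      · rw [h] at hk
        exact absurd hk.symm (by rw [DihedralGroup.one_def]; exact nofun)
      · rw [← hk, h]
    rw [hij]
    exact hpow' l

namespace TopJoin

variable {Y : Type v} [MulAction (Multiplicative (ZMod 2)) Y]

/-- A point fixed by a reflection is one of the integers. -/
theorem eq_of_sr_smul_eq (hfree : ∀ y : Y, Multiplicative.ofAdd (1 : ZMod 2) • y ≠ y) (y₀ : Y)
    (i : ZMod 0) (z : TopJoin ℤ Y) (hz : (DihedralGroup.sr i : DihedralGroup 0) • z = z) :
    z = TopJoin.mk (-(i.cast : ℤ)) y₀ 0 := by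
  induction z using TopJoin.ind with | h x y q =>
  rw [smul_mk] at hz
  have hq : q = 0 := by
    by_contra hq
    exact hfree y (right_eq_of_mk_eq hz (lt_of_le_of_ne q.2.1 (Ne.symm hq)))
  subst hq
  have hx := left_eq_of_mk_eq hz zero_lt_one
  change -(x + 2 * (i.cast : ℤ)) = x at hx
  obtain rfl : x = -(i.cast : ℤ) := by omega
  exact mk_zero _ _ _

theorem fixedPoints_of_sr_mem (hfree : ∀ y : Y, Multiplicative.ofAdd (1 : ZMod 2) • y ≠ y) (y₀ : Y)
    {H : Subgroup (DihedralGroup 0)} {i : ZMod 0} (hi : DihedralGroup.sr i ∈ H) (hH : IsCyclic H) :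
    MulAction.fixedPoints H (TopJoin ℤ Y) = {TopJoin.mk (-(i.cast : ℤ)) y₀ 0} := by
  refine Set.Subset.antisymm (fun z hz => eq_of_sr_smul_eq hfree y₀ i z (hz ⟨_, hi⟩)) ?_
  rintro _ rfl ⟨g, hg⟩
  change g • (TopJoin.mk _ _ _ : TopJoin ℤ Y) = TopJoin.mk _ _ _
  rcases eq_one_or_eq_sr_of_isCyclic hH hi hg with rfl | rfl
  · rw [one_smul]
  · rw [smul_mk]
    have : dihedralOnInt (.sr i) (-(i.cast : ℤ)) = -(i.cast : ℤ) := by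
      change -(-(i.cast : ℤ) + 2 * (i.cast : ℤ)) = _
      ring
    rw [this]
    exact mk_zero _ _ _

/-- The fixed point must be the integer fixed by `sr i`, and its stabilizer contains no other
reflection and no nontrivial translation. -/
theorem isCyclic_of_sr_mem (hfree : ∀ y : Y, Multiplicative.ofAdd (1 : ZMod 2) • y ≠ y)
    {H : Subgroup (DihedralGroup 0)} {i : ZMod 0} (hi : DihedralGroup.sr i ∈ H) (z : TopJoin ℤ Y)
    (hz : z ∈ MulAction.fixedPoints H (TopJoin ℤ Y)) : IsCyclic H := by
  have y₀ : Y := TopJoin.ind (P := fun _ => Nonempty Y) (fun _ y _ => ⟨y⟩) z |>.some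
  refine isCyclic_of_le_zpowers (g := .sr i) fun g hg => ?_
  have h1 := eq_of_sr_smul_eq hfree y₀ i z (hz ⟨_, hi⟩)
  have h2 : g • z = z := hz ⟨g, hg⟩
  rcases g with j | j
  · rw [h1, smul_mk] at h2
    have := left_eq_of_mk_eq h2 zero_lt_one
    change -(i.cast : ℤ) + 2 * (j.cast : ℤ) = _ at this
    have hj : (j.cast : ℤ) = 0 := by omega
    have hj' : j = 0 := by rw [← ZMod.intCast_zmod_cast j, hj, Int.cast_zero]
    rw [hj']
    exact Subgroup.one_mem _
  · have h3 := eq_of_sr_smul_eq hfree y₀ j z h2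
    rw [h1] at h3
    have := left_eq_of_mk_eq h3 zero_lt_one
    have hj : (i.cast : ℤ) = j.cast := neg_injective this
    have hj' : j = i := by rw [← ZMod.intCast_zmod_cast j, ← hj, ZMod.intCast_zmod_cast]
    rw [hj']
    exact Subgroup.mem_zpowers _

/-- A nontrivial translation moves every integer, so a fixed point lies at the end `q = 1`; there
translations act trivially since their sign is 1. -/
theorem fixedPoints_of_r_mem {H : Subgroup (DihedralGroup 0)}
    (hH : ∀ g ∈ H, ∃ i, g = DihedralGroup.r i) {i : ZMod 0} (hi : DihedralGroup.r i ∈ H)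
    (hi0 : i ≠ 0) : MulAction.fixedPoints H (TopJoin ℤ Y) =
      Set.range fun y : Y => TopJoin.mk (0 : ℤ) y 1 := by
  refine Set.Subset.antisymm ?_ ?_
  · refine TopJoin.ind fun x y q hz => ?_
    have h1 : (DihedralGroup.r i : DihedralGroup 0) • TopJoin.mk x y q = TopJoin.mk x y q :=
      hz ⟨_, hi⟩
    rw [smul_mk] at h1
    have hq : q = 1 := by
      by_contra hq
      have h2 := left_eq_of_mk_eq h1 (lt_of_le_of_ne q.2.2 hq)
      change x + 2 * (i.cast : ℤ) = x at h2
      have hj : (i.cast : ℤ) = 0 := by omega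
      exact hi0 (by rw [← ZMod.intCast_zmod_cast i, hj, Int.cast_zero])
    subst hq
    exact ⟨y, mk_one _ _ _⟩
  · rintro _ ⟨y, rfl⟩ ⟨g, hg⟩
    change g • (TopJoin.mk _ _ _ : TopJoin ℤ Y) = TopJoin.mk _ _ _
    obtain ⟨j, rfl⟩ := hH g hg
    rw [smul_mk]
    change TopJoin.mk _ ((1 : Multiplicative (ZMod 2)) • y) 1 = _
    rw [one_smul]
    exact mk_one _ _ _

end TopJoin

/-- The join of the integers with a model of finite type for `E(ℤ/2)` is a model of finite type for
`E_Cyc(D_∞)`. -/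
theorem isFiniteTypeModel_topJoin {Y : Type v} [TopologicalSpace Y]
    [MulAction (Multiplicative (ZMod 2)) Y]
    (hY : IsFiniteTypeModel (trivialFamily (Multiplicative (ZMod 2))) Y) :
    IsFiniteTypeModel (cycFamily (DihedralGroup 0)) (TopJoin ℤ Y) := by
  obtain ⟨⟨c, hc⟩, hcontr, hempty⟩ := hY
  have hYc : ContractibleSpace Y := by
    have h1 := hcontr ⊥ rfl
    have h2 : MulAction.fixedPoints (⊥ : Subgroup (Multiplicative (ZMod 2))) Y = Set.univ := by
      refine Set.eq_univ_of_forall ?_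
      rintro y ⟨g, hg⟩
      change g • y = y
      rw [Subgroup.mem_bot.1 hg, one_smul]
    rw [h2] at h1
    exact (Homeomorph.Set.univ Y).symm.contractibleSpace
  have hfree : ∀ y : Y, Multiplicative.ofAdd (1 : ZMod 2) • y ≠ y := by
    intro y hy
    have h1 := hempty ⊤ fun h => by
      have h2 : (⊤ : Subgroup (Multiplicative (ZMod 2))) = ⊥ := h
      have h3 : Multiplicative.ofAdd (1 : ZMod 2) ∈ (⊥ : Subgroup (Multiplicative (ZMod 2))) :=
        h2 ▸ Subgroup.mem_top _
      exact absurd (Subgroup.mem_bot.1 h3) (by decide)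
    have h2 : y ∈ MulAction.fixedPoints (⊤ : Subgroup (Multiplicative (ZMod 2))) Y := by
      rintro ⟨g, -⟩
      change g • y = y
      have hg : ∀ g : Multiplicative (ZMod 2), g = 1 ∨ g = Multiplicative.ofAdd (1 : ZMod 2) := by
        decide
      rcases hg g with rfl | rfl
      · exact one_smul _ _
      · exact hy
    rw [h1] at h2
    exact h2
  obtain ⟨y₀⟩ : Nonempty Y := inferInstance
  refine ⟨TopJoin.exists_gcwComplex_finiteType c hc y₀, fun H hH => ?_, fun H hH => ?_⟩
  · have hH' : IsCyclic H := hH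
    -- The three cases have as fixed point set one integer, the copy of `Y`, and the whole join.
    by_cases hsr : ∃ i, DihedralGroup.sr i ∈ H
    · obtain ⟨i, hi⟩ := hsr
      rw [TopJoin.fixedPoints_of_sr_mem hfree y₀ hi hH']
      infer_instance
    · have hr : ∀ g ∈ H, ∃ i, g = DihedralGroup.r i := by
        rintro (i | i) hg
        · exact ⟨i, rfl⟩
        · exact (hsr ⟨i, hg⟩).elim
      by_cases h0 : ∃ i, DihedralGroup.r i ∈ H ∧ i ≠ 0
      · obtain ⟨i, hi, hi0⟩ := h0
        rw [TopJoin.fixedPoints_of_r_mem hr hi hi0]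
        exact TopJoin.isClosedEmbedding_mk_one.isEmbedding.toHomeomorph.symm.contractibleSpace
      · have h1 : MulAction.fixedPoints H (TopJoin ℤ Y) = Set.univ := by
          refine Set.eq_univ_of_forall ?_
          rintro z ⟨g, hg⟩
          change g • z = z
          obtain ⟨i, rfl⟩ := hr g hg
          have : i = 0 := by
            by_contra h
            exact h0 ⟨i, hg, h⟩
          rw [this]
          exact one_smul _ z
        rw [h1]
        have := TopJoin.contractibleSpace (Y := Y)
        exact (Homeomorph.Set.univ _).contractibleSpace
  · refine Set.eq_empty_of_forall_notMem fun z hz => hH ?_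
    by_cases hsr : ∃ i, DihedralGroup.sr i ∈ H
    · obtain ⟨i, hi⟩ := hsr
      exact TopJoin.isCyclic_of_sr_mem hfree hi z hz
    · refine isCyclic_of_le_zpowers (g := .r 1) ?_
      rintro (i | i) hg
      · exact mem_zpowers_r_one i
      · exact (hsr ⟨i, hg⟩).elim

/-! ### Virtually cyclic groups covered by finitely many conjugacy classes of cyclic subgroups -/

section VirtuallyCyclic

variable {G : Type u} [Group G]

theorem eq_one_of_isOfFinOrder_of_isCyclic {K : Subgroup G} (hK : IsCyclic K) {x y : G}
    (hx : x ∈ K) (hy : y ∈ K) (hx' : ¬ IsOfFinOrder x) (hy' : IsOfFinOrder y) : y = 1 := by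
  obtain ⟨⟨a, ha⟩, hgen⟩ := hK.exists_generator
  have hpow : ∀ b ∈ K, ∃ k : ℤ, a ^ k = b := by
    intro b hb
    obtain ⟨k, hk⟩ := Subgroup.mem_zpowers_iff.1 (hgen ⟨b, hb⟩)
    exact ⟨k, congrArg Subtype.val hk⟩
  obtain ⟨k, rfl⟩ := hpow x hx
  obtain ⟨l, rfl⟩ := hpow y hy
  have ha' : ¬ IsOfFinOrder a := fun h => hx' h.zpow
  obtain ⟨n, hn, h⟩ := isOfFinOrder_iff_zpow_eq_one.1 hy'
  rw [← zpow_mul] at h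
  have h0 : l * n = 0 := by
    by_contra hne
    exact ha' (isOfFinOrder_iff_zpow_eq_one.2 ⟨_, hne, h⟩)
  rcases mul_eq_zero.1 h0 with h | h
  · rw [h, zpow_zero]
  · exact (hn h).elim

theorem zpow_injective_of_not_isOfFinOrder {z : G} (hz : ¬ IsOfFinOrder z) {k l : ℤ}
    (h : z ^ k = z ^ l) : k = l :=
  injective_zpow_iff_not_isOfFinOrder.2 hz h

/-- If conjugation by `g` and `g⁻¹` maps an element of infinite order to powers of itself, then it
fixes or inverts this element. -/
theorem conj_eq_or_eq_inv {g z : G} (hz : ¬ IsOfFinOrder z) (h1 : ∃ k : ℤ, z ^ k = g * z * g⁻¹)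
    (h2 : ∃ l : ℤ, z ^ l = g⁻¹ * z * g) : g * z * g⁻¹ = z ∨ g * z * g⁻¹ = z⁻¹ := by
  obtain ⟨k, hk⟩ := h1
  obtain ⟨l, hl⟩ := h2
  have h3 : z ^ (k * l) = z ^ (1 : ℤ) := by
    rw [zpow_mul, hk, conj_zpow, hl]
    group
  have h4 := zpow_injective_of_not_isOfFinOrder hz h3
  rcases Int.mul_eq_one_iff_eq_one_or_neg_one.1 h4 with ⟨rfl, -⟩ | ⟨rfl, -⟩
  · left; rw [← hk, zpow_one]
  · right; rw [← hk, zpow_neg_one]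

/-- An infinite virtually cyclic group has an infinite normal cyclic subgroup of finite index. -/
theorem exists_conj_eq_or_eq_inv [Infinite G] (hG : IsVirtuallyCyclic G) :
    ∃ z : G, ¬ IsOfFinOrder z ∧ (Subgroup.zpowers z).FiniteIndex ∧
      ∀ g, g * z * g⁻¹ = z ∨ g * z * g⁻¹ = z⁻¹ := by
  obtain ⟨H, hH, hfin⟩ := hG
  have hN : IsCyclic H.normalCore :=
    isCyclic_of_injective _ (Subgroup.inclusion_injective H.normalCore_le)
  obtain ⟨⟨z, hz⟩, hgen⟩ := hN.exists_generator
  have hpow : ∀ b ∈ H.normalCore, ∃ k : ℤ, z ^ k = b := by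
    intro b hb
    obtain ⟨k, hk⟩ := Subgroup.mem_zpowers_iff.1 (hgen ⟨b, hb⟩)
    exact ⟨k, congrArg Subtype.val hk⟩
  have heq : Subgroup.zpowers z = H.normalCore := by
    refine le_antisymm (by simpa using hz) fun b hb => ?_
    obtain ⟨k, hk⟩ := hpow b hb
    exact Subgroup.mem_zpowers_iff.2 ⟨k, hk⟩
  have hfi : (Subgroup.zpowers z).FiniteIndex := by
    rw [heq]; infer_instance
  have hz' : ¬ IsOfFinOrder z := by
    intro h
    have h1 : Finite (Subgroup.zpowers z) := by
      exact h.finite_zpowers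
    have h2 : Finite (G ⧸ Subgroup.zpowers z) := inferInstance
    have : Finite G := Finite.of_equiv _ (Subgroup.groupEquivQuotientProdSubgroup
      (s := Subgroup.zpowers z)).symm
    exact not_finite G
  have hnorm : ∀ g : G, g * z * g⁻¹ ∈ H.normalCore := fun g => H.normalCore_normal.conj_mem z hz g
  refine ⟨z, hz', hfi, fun g => conj_eq_or_eq_inv hz' (hpow _ (hnorm g)) (hpow _ ?_)⟩
  simpa using hnorm g⁻¹

/-- A torsion-free group with a central cyclic subgroup of finite index is cyclic. -/
theorem isCyclic_of_torsionFree {C : Type u} [Group C] (z : C) (hz : z ∈ Subgroup.center C)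
    (hfin : (Subgroup.zpowers z).FiniteIndex) (htf : ∀ f : C, IsOfFinOrder f → f = 1) :
    IsCyclic C := by
  have hle : Subgroup.zpowers z ≤ Subgroup.center C := by simpa using hz
  have hci : (Subgroup.center C).FiniteIndex := Subgroup.finiteIndex_of_le hle
  -- The transfer into the center is `f ↦ f ^ n`, with `n` the index of the center; its kernel is
  -- torsion. So the group embeds into an abelian group.
  have hinj : Function.Injective (MonoidHom.transferCenterPow C) := by
    rw [injective_iff_map_eq_one]
    intro f hf
    refine htf f (isOfFinOrder_iff_pow_eq_one.2 ⟨(Subgroup.center C).index,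
      Nat.pos_of_ne_zero hci.index_ne_zero, ?_⟩)
    rw [← MonoidHom.transferCenterPow_apply, hf]
    rfl
  have hcomm : ∀ a b : C, Commute a b := fun a b => hinj (by
    rw [map_mul, map_mul]
    exact Subtype.ext (Subgroup.mem_center_iff.1 (MonoidHom.transferCenterPow C b).2 _))
  have hnorm : (Subgroup.zpowers z).Normal := ⟨fun a ha g => by
    rwa [(hcomm g a).eq, mul_inv_cancel_right]⟩
  let ψ : C →* Subgroup.zpowers z :=
    { toFun := fun f => ⟨f ^ (Subgroup.zpowers z).index, Subgroup.pow_index_mem _ f⟩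
      map_one' := Subtype.ext (one_pow _)
      map_mul' := fun a b => Subtype.ext ((hcomm a b).mul_pow _) }
  refine isCyclic_of_injective ψ ((injective_iff_map_eq_one ψ).2 fun f hf => ?_)
  exact htf f (isOfFinOrder_iff_pow_eq_one.2 ⟨_, Nat.pos_of_ne_zero hfin.index_ne_zero,
    congrArg Subtype.val hf⟩)

/-- If finitely many cyclic subgroups contain a conjugate of every element, then the centralizer of
an element that is fixed or inverted by all conjugations is torsion-free. -/
theorem eq_one_of_commute_of_isOfFinOrder {ι : Type*} [Finite ι] (K : ι → Subgroup G)
    (hK : ∀ j, IsCyclic (K j)) (hcover : ∀ h : G, ∃ j g, g * h * g⁻¹ ∈ K j) {z : G}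
    (hz : ¬ IsOfFinOrder z) (hconj : ∀ g, g * z * g⁻¹ = z ∨ g * z * g⁻¹ = z⁻¹) {f : G}
    (hfz : Commute f z) (hf : IsOfFinOrder f) : f = 1 := by
  classical
  have := Fintype.ofFinite ι
  -- If `K j` contains nontrivial powers of `z`, then `b j` is the exponent of one of them;
  -- otherwise the value 1 only keeps the product `m` nonzero.
  have hb : ∀ j, ∃ b : ℤ, b ≠ 0 ∧ ((∃ m : ℤ, m ≠ 0 ∧ z ^ m ∈ K j) → z ^ b ∈ K j) := by
    intro j
    by_cases h : ∃ m : ℤ, m ≠ 0 ∧ z ^ m ∈ K j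
    · obtain ⟨m, hm, hm'⟩ := h
      exact ⟨m, hm, fun _ => hm'⟩
    · exact ⟨1, one_ne_zero, fun h' => (h h').elim⟩
  choose b hb0 hb using hb
  obtain ⟨m, hm0, hm⟩ : ∃ m : ℤ, m ≠ 0 ∧ ∀ j, b j ∣ m :=
    ⟨∏ j, b j, Finset.prod_ne_zero_iff.2 fun j _ => hb0 j,
      fun j => Finset.dvd_prod_of_mem b (Finset.mem_univ j)⟩
  -- The n-th power of `f * z ^ m` is a power of `z`, so this `K j` contains `z ^ b j`, hence `z ^
  -- m`, and therefore a conjugate of `f`. An infinite cyclic group has no torsion.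
  obtain ⟨j, g, hg⟩ := hcover (f * z ^ m)
  obtain ⟨n, hn0, hn⟩ := isOfFinOrder_iff_pow_eq_one.1 hf
  have hmem : ∀ k : ℤ, g * z ^ k * g⁻¹ ∈ K j ↔ z ^ k ∈ K j := by
    intro k
    rw [← conj_zpow]
    rcases hconj g with h | h <;> rw [h]
    rw [inv_zpow, inv_mem_iff]
  have h1 : z ^ (m * n) ∈ K j := by
    rw [← hmem]
    have h2 := (K j).pow_mem hg n
    rwa [conj_pow, (hfz.zpow_right m).mul_pow, hn, one_mul, ← zpow_natCast, ← zpow_mul] at h2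
  have hbj := hb j ⟨_, mul_ne_zero hm0 (by exact_mod_cast hn0.ne'), h1⟩
  have h2 : z ^ m ∈ K j := by
    obtain ⟨d, hd⟩ := hm j
    rw [hd, zpow_mul]
    exact (K j).zpow_mem hbj d
  have h3 : g * f * g⁻¹ ∈ K j := by
    have h4 := (K j).mul_mem hg ((K j).inv_mem ((hmem m).2 h2))
    have h5 : g * (f * z ^ m) * g⁻¹ * (g * z ^ m * g⁻¹)⁻¹ = g * f * g⁻¹ := by group
    rwa [h5] at h4
  have hzm : ¬ IsOfFinOrder (z ^ m) := by
    intro h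
    obtain ⟨k, hk, h'⟩ := isOfFinOrder_iff_zpow_eq_one.1 h
    rw [← zpow_mul] at h'
    exact hz (isOfFinOrder_iff_zpow_eq_one.2 ⟨_, mul_ne_zero hm0 hk, h'⟩)
  have h4 : IsOfFinOrder (g * f * g⁻¹) :=
    isOfFinOrder_iff_pow_eq_one.2 ⟨n, hn0, by rw [conj_pow, hn]; group⟩
  have h5 := eq_one_of_isOfFinOrder_of_isCyclic (hK j) h2 h3 hzm h4
  exact conj_eq_one_iff.1 h5

/-- The isomorphism with the infinite dihedral group given by a reflection and a translation. -/
theorem nonempty_mulEquiv_dihedralGroup {g c : G} (hc : ¬ IsOfFinOrder c) (hg : g * g = 1)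
    (hgc : g * c * g⁻¹ = c⁻¹) (hg' : ∀ k : ℤ, c ^ k ≠ g)
    (hcover : ∀ x : G, (∃ k : ℤ, c ^ k = x) ∨ ∃ k : ℤ, g * c ^ k = x) :
    Nonempty (G ≃* DihedralGroup 0) := by
  have hginv : g⁻¹ = g := inv_eq_of_mul_eq_one_left hg
  have hswap : ∀ k : ℤ, c ^ k * g = g * c ^ (-k) := by
    intro k
    have : g * c ^ (-k) * g⁻¹ = c ^ k := by
      rw [← conj_zpow, hgc, inv_zpow, zpow_neg, inv_inv]
    rw [← this, inv_mul_cancel_right]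
  let φ : DihedralGroup 0 → G := fun d => match d with
    | .r i => c ^ (i.cast : ℤ)
    | .sr i => g * c ^ (i.cast : ℤ)
  have hφ : ∀ a b, φ (a * b) = φ a * φ b := by
    have hadd : ∀ i j : ZMod 0, ((i + j).cast : ℤ) = i.cast + j.cast := fun i j => by simp
    have hsub : ∀ i j : ZMod 0, ((i - j).cast : ℤ) = i.cast - j.cast := fun i j => by simp
    rintro (i | i) (j | j)
    · change c ^ ((i + j).cast : ℤ) = c ^ (i.cast : ℤ) * c ^ (j.cast : ℤ)
      rw [hadd, zpow_add]
    · change g * c ^ ((j - i).cast : ℤ) = c ^ (i.cast : ℤ) * (g * c ^ (j.cast : ℤ))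
      rw [hsub, ← mul_assoc, hswap, mul_assoc, ← zpow_add]
      congr 2; ring
    · change g * c ^ ((i + j).cast : ℤ) = g * c ^ (i.cast : ℤ) * c ^ (j.cast : ℤ)
      rw [hadd, zpow_add, mul_assoc]
    · change c ^ ((j - i).cast : ℤ) = g * c ^ (i.cast : ℤ) * (g * c ^ (j.cast : ℤ))
      rw [hsub, mul_assoc, ← mul_assoc (c ^ (i.cast : ℤ)), hswap, ← mul_assoc, ← mul_assoc, hg,
        one_mul, ← zpow_add]
      congr 1; ring
  have hcast : ∀ i j : ZMod 0, (i.cast : ℤ) = j.cast → i = j := fun i j h => by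
    rw [← ZMod.intCast_zmod_cast i, h, ZMod.intCast_zmod_cast]
  have hinj : Function.Injective φ := by
    rintro (i | i) (j | j) h
    · rw [hcast i j (zpow_injective_of_not_isOfFinOrder hc h)]
    · have h' : c ^ (i.cast : ℤ) = g * c ^ (j.cast : ℤ) := h
      refine (hg' ((i.cast : ℤ) - j.cast) ?_).elim
      rw [zpow_sub, h', mul_inv_cancel_right]
    · have h' : g * c ^ (i.cast : ℤ) = c ^ (j.cast : ℤ) := h
      refine (hg' ((j.cast : ℤ) - i.cast) ?_).elim
      rw [zpow_sub, ← h', mul_inv_cancel_right]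
    · have h' : g * c ^ (i.cast : ℤ) = g * c ^ (j.cast : ℤ) := h
      rw [hcast i j (zpow_injective_of_not_isOfFinOrder hc (mul_left_cancel h'))]
  have hsurj : Function.Surjective φ := by
    intro x
    rcases hcover x with ⟨k, rfl⟩ | ⟨k, rfl⟩
    · exact ⟨.r ((k : ℤ) : ZMod 0), by change c ^ (((k : ℤ) : ZMod 0).cast : ℤ) = c ^ k; simp⟩
    · exact ⟨.sr ((k : ℤ) : ZMod 0), by
        change g * c ^ (((k : ℤ) : ZMod 0).cast : ℤ) = g * c ^ k; simp⟩
  exact ⟨(MulEquiv.ofBijective (MulHom.mk φ hφ) ⟨hinj, hsurj⟩).symm⟩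

/-- An infinite virtually cyclic group in which finitely many cyclic subgroups contain a conjugate
of every element is infinite cyclic or infinite dihedral. -/
theorem isCyclic_or_dihedral_of_cover [Infinite G] (hG : IsVirtuallyCyclic G) {ι : Type*} [Finite ι]
    (K : ι → Subgroup G) (hK : ∀ j, IsCyclic (K j))
    (hcover : ∀ h : G, ∃ j g, g * h * g⁻¹ ∈ K j) :
    IsCyclic G ∨ Nonempty (G ≃* DihedralGroup 0) := by
  obtain ⟨z, hz, hfin, hconj⟩ := exists_conj_eq_or_eq_inv hG
  -- Every element outside `C` inverts `z`, so a product of two such elements lies in `C`: the index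
  -- is at most two.
  let C : Subgroup G := Subgroup.centralizer {z}
  have hmemC : ∀ x, x ∈ C ↔ Commute x z := fun x => by
    rw [Subgroup.mem_centralizer_singleton_iff]
    rfl
  have hzC : z ∈ C := (hmemC z).2 (Commute.refl z)
  have hCc : IsCyclic C := by
    refine isCyclic_of_torsionFree (⟨z, hzC⟩ : C) ?_ ?_ ?_
    · rw [Subgroup.mem_center_iff]
      rintro ⟨x, hx⟩
      exact Subtype.ext ((hmemC x).1 hx)
    · have h1 : Subgroup.zpowers (⟨z, hzC⟩ : C) = (Subgroup.zpowers z).subgroupOf C := by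
        ext x
        rw [Subgroup.mem_subgroupOf, Subgroup.mem_zpowers_iff, Subgroup.mem_zpowers_iff]
        exact ⟨fun ⟨k, hk⟩ => ⟨k, congrArg Subtype.val hk⟩, fun ⟨k, hk⟩ => ⟨k, Subtype.ext hk⟩⟩
      rw [h1]
      infer_instance
    · rintro ⟨f, hf⟩ hf'
      refine Subtype.ext (eq_one_of_commute_of_isOfFinOrder K hK hcover hz hconj
        ((hmemC f).1 hf) ?_)
      exact C.subtype.isOfFinOrder hf'
  obtain ⟨⟨c, hcC⟩, hgen⟩ := hCc.exists_generator
  have hpow : ∀ b ∈ C, ∃ k : ℤ, c ^ k = b := by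
    intro b hb
    obtain ⟨k, hk⟩ := Subgroup.mem_zpowers_iff.1 (hgen ⟨b, hb⟩)
    exact ⟨k, congrArg Subtype.val hk⟩
  by_cases hCtop : ∀ g, g ∈ C
  · left
    exact ⟨⟨c, fun x => Subgroup.mem_zpowers_iff.2 (hpow x (hCtop x))⟩⟩
  right
  push Not at hCtop
  obtain ⟨g, hgC⟩ := hCtop
  have hinv : ∀ x, x ∉ C → x * z * x⁻¹ = z⁻¹ := by
    intro x hx
    refine (hconj x).resolve_left fun h => hx ((hmemC x).2 ?_)
    exact mul_inv_eq_iff_eq_mul.1 h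
  have hprod : ∀ x y, x ∉ C → y ∉ C → x * y ∈ C := by
    intro x y hx hy
    rw [hmemC]
    refine mul_inv_eq_iff_eq_mul.1 (?_ : x * y * z * (x * y)⁻¹ = z)
    have : x * y * z * (x * y)⁻¹ = x * (y * z * y⁻¹) * x⁻¹ := by group
    rw [this, hinv y hy, ← conj_inv, hinv x hx, inv_inv]
  have hnormC : ∀ x y, y ∈ C → x * y * x⁻¹ ∈ C := by
    intro x y hy
    by_cases hx : x ∈ C
    · exact C.mul_mem (C.mul_mem hx hy) (C.inv_mem hx)
    · have hxy : x * y ∉ C := fun h => hx (by simpa using C.mul_mem h (C.inv_mem hy))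
      exact hprod _ _ hxy fun h => hx (by simpa using C.inv_mem h)
  obtain ⟨k, hk⟩ := hpow z hzC
  have hc : ¬ IsOfFinOrder c := fun h => hz (hk ▸ h.zpow)
  -- If `g` fixed `c`, it would fix the power `z` of `c`, which it inverts.
  have hgc : g * c * g⁻¹ = c⁻¹ := by
    refine (conj_eq_or_eq_inv hc (hpow _ (hnormC g c hcC)) (hpow _ ?_)).resolve_left fun h => ?_
    · simpa using hnormC g⁻¹ c hcC
    · have h1 := hinv g hgC
      rw [← hk, ← conj_zpow, h] at h1
      have h2 : c ^ k = c ^ (-k) := by rw [h1, zpow_neg]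
      have h3 := zpow_injective_of_not_isOfFinOrder hc h2
      have h4 : k = 0 := by omega
      rw [h4, zpow_zero] at hk
      exact hz (hk ▸ IsOfFinOrder.one)
  -- The square of `g` is a power of `c`; conjugation by `g` fixes it and also inverts it, so the
  -- exponent is 0.
  have hgg : g * g = 1 := by
    obtain ⟨j, hj⟩ := hpow _ (hprod g g hgC hgC)
    have h1 : g * c ^ j * g⁻¹ = c ^ j := by rw [hj]; group
    rw [← conj_zpow, hgc, inv_zpow, ← zpow_neg] at h1
    have h2 := zpow_injective_of_not_isOfFinOrder hc h1
    have h3 : j = 0 := by omega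
    rw [← hj, h3, zpow_zero]
  refine nonempty_mulEquiv_dihedralGroup hc hgg hgc
    (fun k hk => hgC (hk ▸ C.zpow_mem hcC k)) fun x => ?_
  by_cases hx : x ∈ C
  · exact Or.inl (hpow x hx)
  · obtain ⟨k, hk⟩ := hpow _ (hprod g x hgC hx)
    exact Or.inr ⟨k, by rw [hk, ← mul_assoc, hgg, one_mul]⟩

/-- A `G`-CW-complex of finite type with finitely many orbits of `0`-cells provides finitely many
cyclic subgroups that contain a conjugate of every element. -/
theorem exists_cyclic_cover {X : Type v} [TopologicalSpace X] [MulAction G X]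
    (hX : IsFiniteTypeModel (cycFamily G) X) :
    ∃ (ι : Type v) (_ : Finite ι) (K : ι → Subgroup G), (∀ j, IsCyclic (K j)) ∧
      ∀ h : G, ∃ j g, g * h * g⁻¹ ∈ K j := by
  obtain ⟨⟨c, hc⟩, hcontr, hempty⟩ := hX
  let _ := c.cellAction
  -- The stabilizer of a 0-cell fixes a point and is therefore cyclic. Conversely ⟨h⟩ has a fixed
  -- point, hence fixes a 0-cell, which can be moved to its orbit representative.
  refine ⟨MulAction.orbitRel.Quotient G (c.cell 0), hc 0,
    fun q => MulAction.stabilizer G (Quotient.out q), fun q => ?_, fun h => ?_⟩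
  · by_contra hq
    have h1 := hempty _ hq
    have h2 : c.map 0 (Quotient.out q) 0 ∈ MulAction.fixedPoints
        (MulAction.stabilizer G (Quotient.out q)) X := by
      rintro ⟨g, hg⟩
      change g • c.map 0 (Quotient.out q) 0 = c.map 0 (Quotient.out q) 0
      rw [← c.map_smul 0 g _ 0 (by simp), MulAction.mem_stabilizer_iff.1 hg]
    rw [h1] at h2
    exact h2
  · have h1 := hcontr (Subgroup.zpowers h) (inferInstanceAs (IsCyclic (Subgroup.zpowers h)))
    obtain ⟨x, hx⟩ : Nonempty (MulAction.fixedPoints (Subgroup.zpowers h) X) := inferInstance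
    obtain ⟨i, hi⟩ := c.exists_fixed_zero_cell (Subgroup.zpowers h) x fun g hg => hx ⟨g, hg⟩
    have hi' : h • i = i := hi h (Subgroup.mem_zpowers h)
    have h2 : MulAction.orbitRel G (c.cell 0)
        (Quotient.out (Quotient.mk (MulAction.orbitRel G (c.cell 0)) i)) i :=
      @Quotient.mk_out _ (MulAction.orbitRel G (c.cell 0)) i
    obtain ⟨g, hg⟩ := MulAction.orbitRel_apply.1 h2
    refine ⟨Quotient.mk (MulAction.orbitRel G (c.cell 0)) i, g, ?_⟩
    rw [MulAction.mem_stabilizer_iff, ← hg]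
    change (g * h * g⁻¹) • g • i = g • i
    rw [← mul_smul, inv_mul_cancel_right, mul_smul, hi']

end VirtuallyCyclic

end

/-! ### The classification -/

/-- Finite type models for the families of cyclic subgroups are transported along isomorphisms of
groups. -/
theorem IsFiniteTypeModel.compHom_mulEquiv {G : Type u} {G' : Type*} [Group G] [Group G']
    (e : G ≃* G') {X : Type v} [TopologicalSpace X] [act : MulAction G' X]
    (hX : IsFiniteTypeModel (cycFamily G') X) :
    @IsFiniteTypeModel G _ (cycFamily G) X _ (MulAction.compHom X e.toMonoidHom) := by
  obtain ⟨⟨c, hc⟩, hfix, hempty⟩ := hX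
  let actG : MulAction G X := MulAction.compHom X e.toMonoidHom
  have hmem : ∀ H : Subgroup G, H.map e.toMonoidHom ∈ (cycFamily G').carrier ↔
      H ∈ (cycFamily G).carrier := fun H =>
    ((e.subgroupMap H).isCyclic).symm
  have hset : ∀ H : Subgroup G, MulAction.fixedPoints H X =
      MulAction.fixedPoints (H.map e.toMonoidHom) X := by
    intro H
    ext x
    constructor
    · rintro hx ⟨_, h, hh, rfl⟩
      exact hx ⟨h, hh⟩
    · exact fun hx h => hx ⟨e h, h, h.2, rfl⟩
  refine ⟨⟨?_, ?_⟩, fun H hH => ?_, fun H hH => ?_⟩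
  · exact
      { c with
        continuousConstSMul := ⟨fun g => c.continuousConstSMul.continuous_const_smul (e g)⟩
        cellAction := fun n =>
          letI := c.cellAction n
          MulAction.compHom (c.cell n) e.toMonoidHom
        map_smul := fun n g i p hp => c.map_smul n (e g) i p hp }
  · intro n
    let _ := c.cellAction n
    have : Finite (MulAction.orbitRel.Quotient G' (c.cell n)) := hc n
    let _ : MulAction G (c.cell n) := MulAction.compHom (c.cell n) e.toMonoidHom
    refine Finite.of_surjective (α := MulAction.orbitRel.Quotient G' (c.cell n))
      (β := MulAction.orbitRel.Quotient G (c.cell n)) (Quotient.map' id ?_) ?_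
    · rintro i j ⟨g, hg⟩
      refine ⟨e.symm g, ?_⟩
      change e (e.symm g) • j = i
      rw [e.apply_symm_apply]
      exact hg
    · exact Quotient.ind' fun i => ⟨Quotient.mk'' i, rfl⟩
  · rw [hset]
    exact hfix _ ((hmem H).2 hH)
  · rw [hset]
    exact hempty _ fun h => hH ((hmem H).1 h)

/-- The iterated cone on a point with trivial action is a finite type model for a cyclic group. -/
theorem exists_isFiniteTypeModel_of_isCyclic {G : Type u} [Group G] [IsCyclic G] :
    ∃ (X : Type v) (_ : TopologicalSpace X) (_ : MulAction G X),
      IsFiniteTypeModel (cycFamily G) X := by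
  let act : MulAction G PUnit.{v + 1} :=
    { smul := fun _ x => x
      one_smul := fun _ => rfl
      mul_smul := fun _ _ _ => rfl }
  exact ⟨IteratedCone PUnit.{v + 1}, inferInstance, inferInstance,
    isFiniteTypeModel_iteratedCone _ _ fun H =>
      ⟨fun _ => ⟨PUnit.unit, fun _ _ => rfl⟩, fun _ => Subgroup.isCyclic H⟩⟩

theorem mainTheorem8 :
    -- there are models of finite type for `E(ℤ/2)`
    (∃ (Y : Type v) (_ : TopologicalSpace Y) (_ : MulAction (Multiplicative (ZMod 2)) Y),
      IsFiniteTypeModel (trivialFamily (Multiplicative (ZMod 2))) Y) ∧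
    -- for each of them, the join `ℤ * E(ℤ/2)` is a model of finite type for `E_Cyc(D_∞)`
    (∀ (Y : Type v) [TopologicalSpace Y] [MulAction (Multiplicative (ZMod 2)) Y],
      IsFiniteTypeModel (trivialFamily (Multiplicative (ZMod 2))) Y →
        IsFiniteTypeModel (cycFamily (DihedralGroup 0)) (TopJoin ℤ Y)) ∧
    -- every model for `E_Cyc(D_∞)` is infinite-dimensional
    (∀ (X : Type v) [TopologicalSpace X] [MulAction (DihedralGroup 0) X]
      (c : GCWComplex (DihedralGroup 0) X),
      HasClassifyingFixedPoints (cycFamily (DihedralGroup 0)) X → ¬ c.FiniteDimensional) ∧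
    -- the virtually cyclic groups with a model of finite type for `E_Cyc`
    (∀ (G : Type u) [Group G], IsVirtuallyCyclic G →
      ((∃ (X : Type v) (_ : TopologicalSpace X) (_ : MulAction G X),
          IsFiniteTypeModel (cycFamily G) X) ↔
        Finite G ∨ (IsCyclic G ∧ Infinite G) ∨ Nonempty (G ≃* DihedralGroup 0))) := by

  refine ⟨exists_isFiniteTypeModel_of_finite _, fun Y _ _ h => isFiniteTypeModel_topJoin h,
    fun X _ _ c hX => not_finiteDimensional_of_dihedral c hX, fun G _ hG => ⟨?_, ?_⟩⟩
  · rintro ⟨X, _, _, hX⟩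
    rcases finite_or_infinite G with hfin | hinf
    · exact Or.inl hfin
    · obtain ⟨ι, _, K, hK, hcover⟩ := exists_cyclic_cover hX
      exact Or.inr ((isCyclic_or_dihedral_of_cover hG K hK hcover).imp_left fun h => ⟨h, hinf⟩)
  · rintro (hfin | ⟨hcyc, -⟩ | ⟨⟨e⟩⟩)
    · exact exists_isFiniteTypeModel_of_finite _
    · exact exists_isFiniteTypeModel_of_isCyclic
    · obtain ⟨Y, _, _, hY⟩ := exists_isFiniteTypeModel_of_finite.{0, v}
        (trivialFamily (Multiplicative (ZMod 2)))
      exact ⟨TopJoin ℤ Y, inferInstance, MulAction.compHom _ e.toMonoidHom,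
        (isFiniteTypeModel_topJoin hY).compHom_mulEquiv e⟩
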